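/- Let $l\ge 3$, let $\eta=\mathrm{diag}(1,1,-1,\dots,-1)$ be the quadratic form on $\mathbb R^{2,l-1}$ with time coordinates $u,t$ and space coordinates $x_1,\dots,x_{l-1}$, let $G$ be the identity component of $SO(2,l-1)$, let $H\cong SO_0(1,l-1)$ be the stabilizer in $G$ of the unit vector $e_u$, and let $AdS_l=G/H$ with projection $\pi:G\to G/H$. Let $\sigma$ be conjugation by $\mathrm{diag}(1,-1,\dots,-1)$, let $\theta(X)=-X^{T}$, and let $\mathcal Q$, $\mathcal P$ be the $(-1)$-eigenspaces of $\sigma$, $\theta$ in $\mathfrak{so}(2,l-1)$. Let $E_{ab}$ denote the elementary matrices and put $q_0=E_{ut}-E_{tu}$, $q_i=E_{u x_i}+E_{x_i u}$ $(1\le i\le l-1)$, which form a basis of $\mathcal Q$, and $J_1=E_{t x_2}+E_{x_2 t}$, $J_2=q_1$. Let $\mathcal A=\langle J_1,J_2\rangle$, let $\mathcal N$ be the sum of the spaces $\{X: [J_1,X]=\alpha X,\ [J_2,X]=\beta X\}$ with $(\alpha,\beta)\in\{(1,0),(0,1),(1,1),(1,-1)\}$, let $\bar{\mathcal N}=\theta\mathcal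 N$, and let $AN$, $A\bar N$ be the connected subgroups of $G$ with Lie algebras $\mathcal A\oplus\mathcal N$, $\mathcal A\oplus\bar{\mathcal N}$. The singularity $\mathcal S\subset AdS_l$ is the union of the closed orbits of $AN$ and of the closed orbits of $A\bar N$. A vector $X\in\mathcal Q$ is future directed light-like if its norm for the Killing form is $0$ and its $q_0$-coefficient is positive. A point $p$ belongs to the black hole $BH$ if for all $g$ with $\pi(g)=p$ and all future directed light-like $X\in\mathcal Q$ there is $s>0$ with $\pi(g e^{sX})\in\mathcal S$; the horizon is the boundary of $BH$. For $w\in\mathbb R^{l-1}$ with $\|w\|=1$ put $E(w)=q_0+\sum_{i=1}^{l-1}w_iq_i$. Then: 1. Every $E(w)$ is future directed light-like. 2. For all $x,s\in\mathbb R$ and all unit $w$, $\pi(e^{-xq_0}e^{sE(w)})\in\mathcal S$ if and only if $(\cos^2x-w_2^2)s^2-2s\cos x\sin x+\sin^2x=0$. If $\sin x\ne0$ or $\cos^2x\neq w_2^2$, this holds exactly when $s$ is one of the numbers $\frac{\sin x}{\cos x-w_2}$, $\frac{\sin x}{\cos x+w_2}$ (a number with vanishing denominator being omitted). 3. $\pi(e^{-xq_0})\in\mathcal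 S$ if and only if $\sin x=0$. 4. If $\sin x>0$ and $\cos x<0$, there are unit $w$ with $|w_2|<|\cos x|$, and for each such $w$ one has $\pi(e^{-xq_0}e^{sE(w)})\notin\mathcal S$ for all $s>0$; hence $\pi(e^{-xq_0})\notin BH$. 5. If $\sin x>0$ and $\cos x>0$, then for every unit $w$ there is $s>0$ with $\pi(e^{-xq_0}e^{sE(w)})\in\mathcal S$, and $\pi(e^{-xq_0})\in BH$. 6. If $\cos x=0$, then a direction $w$ satisfies $\pi(e^{-xq_0}e^{sE(w)})\notin\mathcal S$ for all $s>0$ if and only if $w_2=0$. 7. There is a genuine black hole: $BH\setminus\mathcal S\ne\emptyset$, $BH\cup\mathcal S\neq AdS_l$, and the horizon is non-empty. -/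

import Mathlib

noncomputable section

namespace AdSBlackHole

open Matrix

/-! Anti de Sitter space of dimension `l = m + 3` as the homogeneous space `SO(2, l-1) / SO(1, l-1)`.
The ambient space is `ℝ^(2, l-1)`, with the two time-like coordinates indexed by `Fin 2` and the
`l - 1 = m + 2` space-like coordinates indexed by `Fin (m + 2)`. -/

/-- Index set of the coordinates of `ℝ^(2, l-1)`, `l = m + 3`. -/
abbrev Idx (m : ℕ) : Type := Fin 2 ⊕ Fin (m + 2)

/-- The diagonal matrix `diag(1, 1, -1, …, -1)` of the quadratic form of `ℝ^(2, l-1)`. -/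
abbrev etaMat (m : ℕ) : Matrix (Idx m) (Idx m) ℝ :=
  LieAlgebra.Orthogonal.indefiniteDiagonal (Fin 2) (Fin (m + 2)) ℝ

/-! ### The Lie algebra `so(2, l-1)` -/

/-- The Lie algebra `so(2, l-1)`. -/
abbrev LieG (m : ℕ) : Type := LieAlgebra.Orthogonal.so' (Fin 2) (Fin (m + 2)) ℝ

theorem etaMat_mul_self (m : ℕ) : etaMat m * etaMat m = 1 := by
  rw [etaMat, LieAlgebra.Orthogonal.indefiniteDiagonal, diagonal_mul_diagonal, ← diagonal_one]
  congr 1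
  funext i
  rcases i with i | i <;> simp

theorem etaMat_transpose (m : ℕ) : (etaMat m)ᵀ = etaMat m := by
  rw [etaMat, LieAlgebra.Orthogonal.indefiniteDiagonal, diagonal_transpose]

theorem mem_so'_iff {m : ℕ} (X : Matrix (Idx m) (Idx m) ℝ) :
    X ∈ LieAlgebra.Orthogonal.so' (Fin 2) (Fin (m + 2)) ℝ ↔ Xᵀ * etaMat m = -(etaMat m * X) := by
  rw [LieAlgebra.Orthogonal.so', mem_skewAdjointMatricesLieSubalgebra,
    mem_skewAdjointMatricesSubmodule, Matrix.IsSkewAdjoint, Matrix.IsAdjointPair, Matrix.mul_neg]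

/-- The matrix exchanging the time coordinate `a` and the space coordinate `i`. -/
def boostMat {m : ℕ} (a : Fin 2) (i : Fin (m + 2)) : Matrix (Idx m) (Idx m) ℝ :=
  Matrix.single (Sum.inl a) (Sum.inr i) 1 + Matrix.single (Sum.inr i) (Sum.inl a) 1

/-- The infinitesimal rotation of the plane of the two time coordinates. -/
def rotMat (m : ℕ) : Matrix (Idx m) (Idx m) ℝ :=
  Matrix.single (Sum.inl 0) (Sum.inl 1) 1 - Matrix.single (Sum.inl 1) (Sum.inl 0) 1

theorem boostMat_mem {m : ℕ} (a : Fin 2) (i : Fin (m + 2)) :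
    boostMat a i ∈ LieAlgebra.Orthogonal.so' (Fin 2) (Fin (m + 2)) ℝ := by
  rw [mem_so'_iff]
  ext (p | p) (q | q) <;>
    simp [boostMat, etaMat, LieAlgebra.Orthogonal.indefiniteDiagonal, Matrix.single_apply]
  all_goals grind

theorem rotMat_mem (m : ℕ) :
    rotMat m ∈ LieAlgebra.Orthogonal.so' (Fin 2) (Fin (m + 2)) ℝ := by
  rw [mem_so'_iff]
  ext (p | p) (q | q) <;>
    simp [rotMat, etaMat, LieAlgebra.Orthogonal.indefiniteDiagonal, Matrix.single_apply]

/-- The generator `q₀` of the factor `SO(2)` of the maximal compact subgroup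
`SO(2) × SO(l-1)`. -/
def q0 (m : ℕ) : LieG m := ⟨rotMat m, rotMat_mem m⟩

/-- The elements `q₁, …, q_{l-1}`; the index is shifted by one, `q i` is `q_{i+1}`. -/
def q {m : ℕ} (i : Fin (m + 2)) : LieG m := ⟨boostMat 0 i, boostMat_mem 0 i⟩

/-- The basis element `J₁` of `𝒜`, in `ℋ`. It satisfies `q₂ = -[J₁, q₀]`. -/
def J1 (m : ℕ) : LieG m := ⟨boostMat 1 1, boostMat_mem 1 1⟩

/-- The basis element `J₂ = q₁` of `𝒜`, in `𝒬`. -/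
def J2 (m : ℕ) : LieG m := q 0

/-- The direction `E(w) = q₀ + ∑ w_i q_i`; `w 0, w 1, …` are `w₁, w₂, …`. -/
def E {m : ℕ} (w : EuclideanSpace ℝ (Fin (m + 2))) : LieG m := q0 m + ∑ i, w i • q i

theorem theta_mem {m : ℕ} (X : LieG m) : -(X : Matrix (Idx m) (Idx m) ℝ)ᵀ ∈
    LieAlgebra.Orthogonal.so' (Fin 2) (Fin (m + 2)) ℝ := by
  have h := (mem_so'_iff _).1 X.2
  have h2 : etaMat m * ((X : Matrix (Idx m) (Idx m) ℝ)ᵀ * etaMat m) * etaMat m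
      = etaMat m * (-(etaMat m * (X : Matrix (Idx m) (Idx m) ℝ))) * etaMat m := by rw [h]
  have h3 : etaMat m * (X : Matrix (Idx m) (Idx m) ℝ)ᵀ
      = -((X : Matrix (Idx m) (Idx m) ℝ) * etaMat m) := by
    calc etaMat m * (X : Matrix (Idx m) (Idx m) ℝ)ᵀ
        = etaMat m * (X : Matrix (Idx m) (Idx m) ℝ)ᵀ * (etaMat m * etaMat m) := by
          rw [etaMat_mul_self, Matrix.mul_one]
      _ = etaMat m * ((X : Matrix (Idx m) (Idx m) ℝ)ᵀ * etaMat m) * etaMat m := by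
          simp only [Matrix.mul_assoc]
      _ = -((etaMat m * etaMat m) * (X : Matrix (Idx m) (Idx m) ℝ) * etaMat m) := by
          rw [h2, Matrix.mul_neg, Matrix.neg_mul, ← Matrix.mul_assoc]
      _ = -((X : Matrix (Idx m) (Idx m) ℝ) * etaMat m) := by
          rw [etaMat_mul_self, Matrix.one_mul]
  rw [mem_so'_iff, transpose_neg, transpose_transpose, Matrix.neg_mul, Matrix.mul_neg, h3, neg_neg]

/-- The Cartan involution `θ X = -Xᵀ`. -/
def theta (m : ℕ) : LieG m →ₗ[ℝ] LieG m where
  toFun X := ⟨-(X : Matrix (Idx m) (Idx m) ℝ)ᵀ, theta_mem X⟩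
  map_add' X Y := by
    apply Subtype.ext
    change -((X : Matrix (Idx m) (Idx m) ℝ) + (Y : Matrix (Idx m) (Idx m) ℝ))ᵀ = -(X : Matrix (Idx m) (Idx m) ℝ)ᵀ
      + -(Y : Matrix (Idx m) (Idx m) ℝ)ᵀ
    rw [transpose_add, neg_add]
  map_smul' c X := by
    apply Subtype.ext
    change -(c • (X : Matrix (Idx m) (Idx m) ℝ))ᵀ = c • -(X : Matrix (Idx m) (Idx m) ℝ)ᵀ
    rw [transpose_smul, smul_neg]

/-- `diag(1, -1, …, -1)`: the reflection of `ℝ^(2, l-1)` which fixes the base point `e₀` and is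
`-1` on its orthogonal complement. -/
def sigmaMat (m : ℕ) : Matrix (Idx m) (Idx m) ℝ :=
  Matrix.diagonal fun i => if i = Sum.inl 0 then 1 else -1

theorem sigmaMat_transpose (m : ℕ) : (sigmaMat m)ᵀ = sigmaMat m := by
  rw [sigmaMat, diagonal_transpose]

theorem sigmaMat_comm (m : ℕ) : sigmaMat m * etaMat m = etaMat m * sigmaMat m := by
  rw [sigmaMat, etaMat, LieAlgebra.Orthogonal.indefiniteDiagonal, diagonal_mul_diagonal,
    diagonal_mul_diagonal]
  congr 1
  funext i
  exact mul_comm _ _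

/-- The involutive automorphism `σ` of `so(2, l-1)`, whose fixed points form the Lie algebra of the
stabilizer of the base point. -/
def sigma (m : ℕ) : LieG m →ₗ[ℝ] LieG m where
  toFun X := ⟨sigmaMat m * (X : Matrix (Idx m) (Idx m) ℝ) * sigmaMat m, by
    have h := (mem_so'_iff _).1 X.2
    rw [mem_so'_iff, transpose_mul, transpose_mul, sigmaMat_transpose, Matrix.mul_assoc,
      Matrix.mul_assoc, sigmaMat_comm, ← Matrix.mul_assoc _ (etaMat m), h]
    simp only [Matrix.neg_mul, Matrix.mul_neg, ← Matrix.mul_assoc, sigmaMat_comm]⟩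
  map_add' X Y := by
    ext1
    simp [Matrix.mul_add, Matrix.add_mul]
  map_smul' c X := by
    ext1
    simp

/-- `𝒬`, the `-1` eigenspace of `σ`: the tangent space of `AdS` at the base point. -/
def spaceQ (m : ℕ) : Submodule ℝ (LieG m) := Module.End.eigenspace (sigma m) (-1)

/-- `𝒫`, the `-1` eigenspace of `θ`. -/
def spaceP (m : ℕ) : Submodule ℝ (LieG m) := Module.End.eigenspace (theta m) (-1)

/-- The space `{X | [J₁, X] = α X, [J₂, X] = β X}`. -/
def rootSpace (m : ℕ) (α β : ℝ) : Submodule ℝ (LieG m) :=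
  Module.End.eigenspace (LieAlgebra.ad ℝ (LieG m) (J1 m)) α ⊓
    Module.End.eigenspace (LieAlgebra.ad ℝ (LieG m) (J2 m)) β

/-- `𝒜 = ⟨J₁, J₂⟩`, maximal abelian in `𝒫`. -/
def spaceA (m : ℕ) : Submodule ℝ (LieG m) := Submodule.span ℝ {J1 m, J2 m}

/-- `𝒩`, the sum of the positive root spaces `⟨X_{+0}^k⟩`, `⟨X_{0+}^k⟩`, `⟨X_{++}⟩`, `⟨X_{+-}⟩`. -/
def spaceN (m : ℕ) : Submodule ℝ (LieG m) :=
  rootSpace m 1 0 ⊔ rootSpace m 0 1 ⊔ rootSpace m 1 1 ⊔ rootSpace m 1 (-1)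

/-- `𝒩̄ = θ 𝒩`. -/
def spaceNbar (m : ℕ) : Submodule ℝ (LieG m) := (spaceN m).map (theta m)

/-! ### The group, the homogeneous space and the exponential -/

/-- `SO(2, l-1)`, with all its components. -/
def fullSO (m : ℕ) : Subgroup (Matrix (Idx m) (Idx m) ℝ)ˣ where
  carrier := {g | g.valᵀ * etaMat m * g.val = etaMat m ∧ g.val.det = 1}
  one_mem' := ⟨by simp, by simp⟩
  mul_mem' := by
    rintro a b ⟨ha, ha'⟩ ⟨hb, hb'⟩
    refine ⟨?_, by rw [Units.val_mul, det_mul, ha', hb', one_mul]⟩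
    calc (a * b).valᵀ * etaMat m * (a * b).val
        = b.valᵀ * (a.valᵀ * etaMat m * a.val) * b.val := by
          rw [Units.val_mul, transpose_mul]
          simp only [Matrix.mul_assoc]
      _ = etaMat m := by rw [ha, hb]
  inv_mem' := by
    rintro a ⟨ha, ha'⟩
    have h1 : a.val * (a⁻¹).val = 1 := a.mul_inv
    have h2 : (a⁻¹).valᵀ * a.valᵀ = 1 := by rw [← transpose_mul, h1, transpose_one]
    constructor
    · calc (a⁻¹).valᵀ * etaMat m * (a⁻¹).val
          = (a⁻¹).valᵀ * (a.valᵀ * etaMat m * a.val) * (a⁻¹).val := by rw [ha]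
        _ = ((a⁻¹).valᵀ * a.valᵀ) * etaMat m * (a.val * (a⁻¹).val) := by
          simp only [Matrix.mul_assoc]
        _ = etaMat m := by rw [h1, h2, Matrix.one_mul, Matrix.mul_one]
    · have h3 := congrArg Matrix.det h1
      rwa [det_mul, ha', det_one, one_mul] at h3

/-- The group `G`: the identity component of `SO(2, l-1)`, with maximal compact subgroup
`SO(2) × SO(l-1)`. -/
abbrev GroupG (m : ℕ) : Type := ↥(Subgroup.connectedComponentOfOne (fullSO m))

/-- The matrix of an element of `G`. -/
def GroupG.mat {m : ℕ} (g : GroupG m) : Matrix (Idx m) (Idx m) ℝ :=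
  ((g : fullSO m) : (Matrix (Idx m) (Idx m) ℝ)ˣ).val

/-- The base vector `e₀` of `ℝ^(2, l-1)`. -/
def e0 (m : ℕ) : Idx m → ℝ := Pi.single (Sum.inl 0) 1

/-- The subgroup `H` of `G`, the copy `{diag(1, h)}` of (the identity component of) `SO(1, l-1)`
formed by the elements of `G` that fix `e₀`. -/
def subgroupH (m : ℕ) : Subgroup (GroupG m) where
  carrier := {g | g.mat *ᵥ e0 m = e0 m}
  one_mem' := one_mulVec _
  mul_mem' := by
    intro a b (ha : a.mat *ᵥ e0 m = e0 m) (hb : b.mat *ᵥ e0 m = e0 m)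
    change (a.mat * b.mat) *ᵥ e0 m = e0 m
    rw [← mulVec_mulVec, hb, ha]
  inv_mem' := by
    intro a (ha : a.mat *ᵥ e0 m = e0 m)
    have h : (a⁻¹).mat * a.mat = 1 := Units.inv_mul _
    change (a⁻¹).mat *ᵥ e0 m = e0 m
    calc (a⁻¹).mat *ᵥ e0 m = (a⁻¹).mat *ᵥ (a.mat *ᵥ e0 m) := by rw [ha]
      _ = e0 m := by rw [mulVec_mulVec, h, one_mulVec]

/-- Anti de Sitter space `AdS_l = G / H`, `l = m + 3`, with the quotient topology and the left
action of `G`. -/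
abbrev AdS (m : ℕ) : Type := GroupG m ⧸ subgroupH m

/-- The projection `π : G → G / H`. -/
def proj {m : ℕ} (g : GroupG m) : AdS m := QuotientGroup.mk g

theorem exp_preserves {m : ℕ} (X : LieG m) :
    (NormedSpace.exp (X : Matrix (Idx m) (Idx m) ℝ))ᵀ * etaMat m *
      NormedSpace.exp (X : Matrix (Idx m) (Idx m) ℝ) = etaMat m := by
  have h := (mem_so'_iff _).1 X.2
  have hu : IsUnit (etaMat m) := IsUnit.of_mul_eq_one _ (etaMat_mul_self m)
  have hinv : (etaMat m)⁻¹ = etaMat m := Matrix.inv_eq_left_inv (etaMat_mul_self m)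
  have h2 : (X : Matrix (Idx m) (Idx m) ℝ)ᵀ
      = etaMat m * (-(X : Matrix (Idx m) (Idx m) ℝ)) * (etaMat m)⁻¹ := by
    rw [hinv, mul_neg, ← h, Matrix.mul_assoc, etaMat_mul_self, Matrix.mul_one]
  rw [← Matrix.exp_transpose, h2, Matrix.exp_conj _ _ hu, hinv, Matrix.mul_assoc (etaMat m * _),
    etaMat_mul_self, Matrix.mul_one, Matrix.mul_assoc,
    ← Matrix.exp_add_of_commute (-(X : Matrix (Idx m) (Idx m) ℝ)) X
      (Commute.neg_left (Commute.refl _)), neg_add_cancel,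
    NormedSpace.exp_zero, Matrix.mul_one]

theorem det_exp {m : ℕ} (X : LieG m) :
    (NormedSpace.exp (X : Matrix (Idx m) (Idx m) ℝ)).det = 1 := by
  have h1 := congrArg Matrix.det (exp_preserves ((1 / 2 : ℝ) • X))
  have h0 : (etaMat m).det ≠ 0 := by
    have := congrArg Matrix.det (etaMat_mul_self m)
    rw [det_mul, det_one] at this
    exact left_ne_zero_of_mul_eq_one this
  rw [det_mul, det_mul, det_transpose] at h1
  have h2 : (X : Matrix (Idx m) (Idx m) ℝ) = (((1 / 2 : ℝ) • X : LieG m) : Matrix (Idx m) (Idx m) ℝ)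
      + (((1 / 2 : ℝ) • X : LieG m) : Matrix (Idx m) (Idx m) ℝ) := by
    change (X : Matrix (Idx m) (Idx m) ℝ) = (1 / 2 : ℝ) • (X : Matrix (Idx m) (Idx m) ℝ)
      + (1 / 2 : ℝ) • (X : Matrix (Idx m) (Idx m) ℝ)
    rw [← add_smul]
    norm_num
  rw [h2, Matrix.exp_add_of_commute _ _ (Commute.refl _), det_mul]
  apply mul_left_cancel₀ h0
  linarith

theorem exp_mul_exp_neg {m : ℕ} (X : LieG m) :
    NormedSpace.exp (X : Matrix (Idx m) (Idx m) ℝ) *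
      NormedSpace.exp (-(X : Matrix (Idx m) (Idx m) ℝ)) = 1 := by
  rw [← Matrix.exp_add_of_commute (X : Matrix (Idx m) (Idx m) ℝ) (-X)
    (Commute.neg_right (Commute.refl _)), add_neg_cancel,
    NormedSpace.exp_zero]

/-- The exponential with values in the full group. -/
def expFull {m : ℕ} (X : LieG m) : fullSO m :=
  ⟨⟨NormedSpace.exp (X : Matrix (Idx m) (Idx m) ℝ),
    NormedSpace.exp (-(X : Matrix (Idx m) (Idx m) ℝ)), exp_mul_exp_neg X,
    mul_eq_one_comm.mp (exp_mul_exp_neg X)⟩, exp_preserves X, det_exp X⟩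

theorem expFull_mem {m : ℕ} (X : LieG m) :
    expFull X ∈ Subgroup.connectedComponentOfOne (fullSO m) := by
  have hc : Continuous fun t : ℝ => expFull (t • X) := by
    let i1 : NormedRing (Matrix (Idx m) (Idx m) ℝ) := Matrix.linftyOpNormedRing
    let i2 : NormedAlgebra ℝ (Matrix (Idx m) (Idx m) ℝ) := Matrix.linftyOpNormedAlgebra
    let i3 : NormedAlgebra ℚ (Matrix (Idx m) (Idx m) ℝ) := NormedAlgebra.restrictScalars ℚ ℝ _
    have h1 : Continuous fun t : ℝ => t • (X : Matrix (Idx m) (Idx m) ℝ) := by fun_prop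
    refine Continuous.subtype_mk (Units.continuous_iff.2 ⟨?_, ?_⟩) _
    · exact NormedSpace.exp_continuous.comp h1
    · exact NormedSpace.exp_continuous.comp h1.neg
  have h0 : expFull ((0 : ℝ) • X) = 1 := by
    rw [zero_smul]
    apply Subtype.ext
    apply Units.ext
    exact NormedSpace.exp_zero
  have h1 : expFull ((1 : ℝ) • X) = expFull X := by rw [one_smul]
  exact (isPreconnected_range hc).subset_connectedComponent ⟨0, h0⟩ ⟨1, h1⟩

/-- The exponential map `so(2, l-1) → G`, given by the exponential of matrices. -/
def expG {m : ℕ} (X : LieG m) : GroupG m := ⟨expFull X, expFull_mem X⟩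

/-- The connected subgroup of `G` generated by the exponentials of the elements of `V`. -/
def expSubgroup {m : ℕ} (V : Submodule ℝ (LieG m)) : Subgroup (GroupG m) :=
  Subgroup.closure (expG '' (V : Set (LieG m)))

/-- The Iwasawa group `AN`. -/
def groupAN (m : ℕ) : Subgroup (GroupG m) := expSubgroup (spaceA m ⊔ spaceN m)

/-- The Iwasawa group `A N̄`. -/
def groupANbar (m : ℕ) : Subgroup (GroupG m) := expSubgroup (spaceA m ⊔ spaceNbar m)

/-! ### Singularity, light-like geodesics, black hole -/

/-- The singularity: the union of the closed orbits of `AN` and of the closed orbits of `A N̄`. -/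
def singularity (m : ℕ) : Set (AdS m) :=
  {p | IsClosed (MulAction.orbit (groupAN m) p) ∨ IsClosed (MulAction.orbit (groupANbar m) p)}

/-- The geodesic `s ↦ π(g e^{sX})` through `π(g)` in the direction `X ∈ 𝒬`. -/
def geodesic {m : ℕ} (g : GroupG m) (X : LieG m) (s : ℝ) : AdS m := proj (g * expG (s • X))

/-- `X ∈ 𝒬` is a future directed light-like vector: its norm for the Killing form vanishes, and its
component in the compact direction `q₀` is positive (`𝒬 = ⟨q₀⟩ ⊕ (𝒬 ∩ 𝒫)`). -/
def IsFutureLightlike {m : ℕ} (X : LieG m) : Prop :=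
  X ∈ spaceQ m ∧ killingForm ℝ (LieG m) X X = 0 ∧ ∃ c : ℝ, 0 < c ∧ X - c • q0 m ∈ spaceP m

/-- The black hole: the points such that every light-like geodesic through the point intersects the
singularity in the future. -/
def blackHole (m : ℕ) : Set (AdS m) :=
  {p | ∀ g : GroupG m, proj g = p → ∀ X : LieG m, IsFutureLightlike X →
    ∃ s : ℝ, 0 < s ∧ geodesic g X s ∈ singularity m}

/-- The horizon: the boundary of the black hole. -/
def horizon (m : ℕ) : Set (AdS m) := frontier (blackHole m)

/-- The representative `e^{-x q₀}` of a point of `[SO(2)]`. -/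
def circlePt (m : ℕ) (x : ℝ) : GroupG m := expG (-(x • q0 m))

end AdSBlackHole

end

noncomputable section

namespace AdSBlackHole

open Matrix

variable {m : ℕ}

/-! ### The ambient quadratic form -/

/-! Sending `g H` to `g e₀` embeds `AdS` in the quadric of vectors of norm 1, and everything is
computed there. The Lie algebra is handled through the elements `rot f w`, whose brackets follow
from the action on vectors (`lie_rot`) and whose exponentials are quadratic polynomials when `f` is
null and orthogonal to `w` (`expG_smul_rot`).

The heart is `mem_singularity_iff`: the singularity is `t² = x₂²`. The group `AN` preserves the null
line of `f = e_t + e_{x₂}`, hence the hyperplane orthogonal to `f`. Off this hyperplane, the flow of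
`J₁` brings an orbit arbitrarily close to `e₀`, which lies on the hyperplane, so the orbit is not
closed. On it, every point can be moved to `e₀` or `-e₀`, and the orbit is the whole section of
`AdS` or one of its two closed halves. Conjugation by `η` gives the same for `A N̄` with `e_t -
e_{x₂}`. Both groups are treated at once by `IsHorospherical`.

A light-like geodesic is a straight line of the ambient space (`vec_geodesic`), so meeting the
singularity is a polynomial equation in `s`, namely `(sin x - s cos x)² = (s w₂)²` for lines
starting on the circle. All statements about the circle are read off its roots.

To conclude about the black hole, its definition must be reduced to the directions `E(w)` at one
representative (`proj_mem_blackHole_iff`). This needs the null vectors for the Killing form,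
obtained from `ad³ = -ν ad` without computing a trace, and the preservation of time orientation by
`H`, which comes from the connectedness of `G`. Connectedness of `AdS` then gives a non-empty
horizon. -/

/-- The bilinear form of `ℝ^(2, l-1)`. -/
def bil (m : ℕ) : (Idx m → ℝ) →ₗ[ℝ] (Idx m → ℝ) →ₗ[ℝ] ℝ := Matrix.toLinearMap₂' ℝ (etaMat m)

theorem bil_eq_dotProduct (v w : Idx m → ℝ) : bil m v w = v ⬝ᵥ (etaMat m *ᵥ w) :=
  Matrix.toLinearMap₂'_apply' _ _ _

theorem etaMat_mulVec_inl (v : Idx m → ℝ) (a : Fin 2) :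
    (etaMat m *ᵥ v) (Sum.inl a) = v (Sum.inl a) := by
  simp [etaMat, LieAlgebra.Orthogonal.indefiniteDiagonal, mulVec_diagonal]

theorem etaMat_mulVec_inr (v : Idx m → ℝ) (i : Fin (m + 2)) :
    (etaMat m *ᵥ v) (Sum.inr i) = -v (Sum.inr i) := by
  simp [etaMat, LieAlgebra.Orthogonal.indefiniteDiagonal, mulVec_diagonal]

theorem bil_apply (v w : Idx m → ℝ) :
    bil m v w = v (Sum.inl 0) * w (Sum.inl 0) + v (Sum.inl 1) * w (Sum.inl 1)
      - ∑ i, v (Sum.inr i) * w (Sum.inr i) := by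
  rw [bil_eq_dotProduct, dotProduct, Fintype.sum_sum_type, Fin.sum_univ_two]
  simp only [etaMat_mulVec_inl, etaMat_mulVec_inr, mul_neg, Finset.sum_neg_distrib]
  ring

theorem bil_comm (v w : Idx m → ℝ) : bil m v w = bil m w v := by
  simp only [bil_apply, mul_comm]

theorem bil_mulVec_left {X : Matrix (Idx m) (Idx m) ℝ} (hX : Xᵀ * etaMat m = -(etaMat m * X))
    (v w : Idx m → ℝ) : bil m (X *ᵥ v) w = -bil m v (X *ᵥ w) := by
  rw [bil_eq_dotProduct, bil_eq_dotProduct, ← vecMul_transpose, ← dotProduct_mulVec,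
    mulVec_mulVec, hX, neg_mulVec, dotProduct_neg, mulVec_mulVec]

theorem LieG.bil_left (X : LieG m) (v w : Idx m → ℝ) :
    bil m (X.1 *ᵥ v) w = -bil m v (X.1 *ᵥ w) :=
  bil_mulVec_left ((mem_so'_iff _).1 X.2) v w

theorem LieG.bil_self (X : LieG m) (v : Idx m → ℝ) : bil m v (X.1 *ᵥ v) = 0 := by
  have h := X.bil_left v v
  rw [bil_comm] at h
  linarith

theorem LieG.ext_mulVec {X Y : LieG m} (h : ∀ v, X.1 *ᵥ v = Y.1 *ᵥ v) : X = Y :=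
  Subtype.ext (Matrix.toLin'.injective (LinearMap.ext fun v => by simpa using h v))

theorem LieG.lie_mulVec (X Y : LieG m) (v : Idx m → ℝ) :
    (⁅X, Y⁆ : LieG m).1 *ᵥ v = X.1 *ᵥ (Y.1 *ᵥ v) - Y.1 *ᵥ (X.1 *ᵥ v) := by
  change (X.1 * Y.1 - Y.1 * X.1) *ᵥ v = _
  rw [Matrix.sub_mulVec, mulVec_mulVec, mulVec_mulVec]

theorem GroupG.bil_mat (g : GroupG m) (v w : Idx m → ℝ) :
    bil m (g.mat *ᵥ v) (g.mat *ᵥ w) = bil m v w := by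
  have h : g.matᵀ * etaMat m * g.mat = etaMat m := g.1.2.1
  rw [bil_eq_dotProduct, bil_eq_dotProduct, ← vecMul_transpose, ← dotProduct_mulVec,
    mulVec_mulVec, mulVec_mulVec, h]

theorem GroupG.mat_mul (g h : GroupG m) : (g * h).mat = g.mat * h.mat := rfl

theorem GroupG.mat_one : (1 : GroupG m).mat = 1 := rfl

theorem GroupG.mul_mulVec (g h : GroupG m) (v : Idx m → ℝ) :
    (g * h).mat *ᵥ v = g.mat *ᵥ (h.mat *ᵥ v) := by
  rw [mat_mul, mulVec_mulVec]

theorem GroupG.inv_mulVec_eq {g : GroupG m} {v w : Idx m → ℝ} (h : g.mat *ᵥ v = w) :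
    (g⁻¹).mat *ᵥ w = v := by
  rw [← h, ← mul_mulVec, inv_mul_cancel, mat_one, one_mulVec]

theorem e0_bil (v : Idx m → ℝ) : bil m (e0 m) v = v (Sum.inl 0) := by
  simp [bil_apply, e0]

/-! ### Infinitesimal rotations -/

/-- The infinitesimal rotation `v ↦ ⟨f, v⟩ w - ⟨w, v⟩ f` of `ℝ^(2, l-1)`. -/
def rot (f w : Idx m → ℝ) : LieG m :=
  ⟨vecMulVec w (etaMat m *ᵥ f) - vecMulVec f (etaMat m *ᵥ w), by
    rw [mem_so'_iff, transpose_sub, transpose_vecMulVec, transpose_vecMulVec, Matrix.sub_mul,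
      Matrix.mul_sub, vecMulVec_mul, vecMulVec_mul, mul_vecMulVec, mul_vecMulVec,
      ← mulVec_transpose, ← mulVec_transpose, etaMat_transpose, neg_sub]⟩

theorem rot_mulVec (f w v : Idx m → ℝ) :
    (rot f w).1 *ᵥ v = bil m f v • w - bil m w v • f := by
  rw [rot, sub_mulVec, vecMulVec_mulVec, vecMulVec_mulVec, bil_comm f, bil_comm w,
    bil_eq_dotProduct, bil_eq_dotProduct, dotProduct_comm v, dotProduct_comm v]
  simp

theorem LieG.add_mulVec (X Y : LieG m) (v : Idx m → ℝ) :
    (X + Y).1 *ᵥ v = X.1 *ᵥ v + Y.1 *ᵥ v := Matrix.add_mulVec _ _ _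

theorem LieG.neg_mulVec (X : LieG m) (v : Idx m → ℝ) :
    (-X).1 *ᵥ v = -(X.1 *ᵥ v) := Matrix.neg_mulVec _ _

theorem LieG.smul_mulVec (c : ℝ) (X : LieG m) (v : Idx m → ℝ) :
    (c • X).1 *ᵥ v = c • (X.1 *ᵥ v) := Matrix.smul_mulVec _ _ _

theorem rot_add (f w w' : Idx m → ℝ) : rot f (w + w') = rot f w + rot f w' := by
  refine LieG.ext_mulVec fun v => ?_
  simp only [LieG.add_mulVec, rot_mulVec, map_add, LinearMap.add_apply]
  module

theorem rot_smul (c : ℝ) (f w : Idx m → ℝ) : rot f (c • w) = c • rot f w := by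
  refine LieG.ext_mulVec fun v => ?_
  simp only [LieG.smul_mulVec, rot_mulVec, map_smul, LinearMap.smul_apply, smul_eq_mul]
  module

theorem rot_self (f : Idx m → ℝ) : rot f f = 0 :=
  LieG.ext_mulVec fun v => by rw [rot_mulVec, sub_self]; exact (Matrix.zero_mulVec v).symm

theorem rot_swap (f w : Idx m → ℝ) : rot f w = -rot w f := by
  refine LieG.ext_mulVec fun v => ?_
  rw [LieG.neg_mulVec, rot_mulVec, rot_mulVec]
  module

/-- Skewness of `X` for the form makes `X` act on `rot` as a derivation. Brackets thereby become
computations with vectors. -/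
theorem lie_rot (X : LieG m) (f w : Idx m → ℝ) :
    ⁅X, rot f w⁆ = rot (X.1 *ᵥ f) w + rot f (X.1 *ᵥ w) := by
  refine LieG.ext_mulVec fun v => ?_
  simp only [LieG.lie_mulVec, LieG.add_mulVec, rot_mulVec, LieG.bil_left, mulVec_sub, mulVec_smul]
  module

/-! ### Exponentials -/

/-- Uniqueness for the linear equation `y' = A y`: the curve `exp(-rA) y(r)` has zero derivative. An
exponential is then found by guessing the flow and differentiating it. -/
theorem exp_smul_mulVec_of_hasDerivAt (A : Matrix (Idx m) (Idx m) ℝ) {y : ℝ → Idx m → ℝ}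
    (hy : ∀ s, HasDerivAt y (A *ᵥ y s) s) (s : ℝ) :
    NormedSpace.exp (s • A) *ᵥ y 0 = y s := by
  let i1 : NormedRing (Matrix (Idx m) (Idx m) ℝ) := Matrix.linftyOpNormedRing
  let i2 : NormedAlgebra ℝ (Matrix (Idx m) (Idx m) ℝ) := Matrix.linftyOpNormedAlgebra
  let i3 : NormedAlgebra ℚ (Matrix (Idx m) (Idx m) ℝ) := NormedAlgebra.restrictScalars ℚ ℝ _
  have hB : ∀ t : ℝ, HasDerivAt (fun r : ℝ => NormedSpace.exp (r • -A))
      (NormedSpace.exp (t • -A) * -A) t := fun t => hasDerivAt_exp_smul_const (-A) t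
  have hφ : ∀ t : ℝ, HasDerivAt (fun r : ℝ => NormedSpace.exp (r • -A) *ᵥ y r) 0 t := by
    intro t
    rw [hasDerivAt_pi]
    intro i
    have hsum : HasDerivAt (fun r : ℝ => ∑ j, NormedSpace.exp (r • -A) i j * y r j)
        (∑ j, ((NormedSpace.exp (t • -A) * -A) i j * y t j
          + NormedSpace.exp (t • -A) i j * (A *ᵥ y t) j)) t := by
      refine HasDerivAt.fun_sum fun j _ => HasDerivAt.mul ?_ (hasDerivAt_pi.1 (hy t) j)
      exact ((LinearMap.toContinuousLinearMap
        (Matrix.entryLinearMap ℝ ℝ i j)).hasFDerivAt.comp_hasDerivAt t (hB t))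
    refine hsum.congr_deriv ?_
    rw [Finset.sum_add_distrib]
    change ((NormedSpace.exp (t • -A) * -A) *ᵥ y t) i
      + (NormedSpace.exp (t • -A) *ᵥ (A *ᵥ y t)) i = 0
    rw [mulVec_mulVec, Matrix.mul_neg, Matrix.neg_mulVec]
    simp
  have hconst := is_const_of_deriv_eq_zero (fun t => (hφ t).differentiableAt)
    (fun t => (hφ t).deriv) s 0
  simp only [zero_smul, NormedSpace.exp_zero, one_mulVec] at hconst
  rw [← hconst, mulVec_mulVec, smul_neg, ← Matrix.exp_add_of_commute (s • A) (-(s • A))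
    (Commute.neg_right (Commute.refl _)), add_neg_cancel, NormedSpace.exp_zero, one_mulVec]

theorem expG_smul_mulVec (X : LieG m) {y : ℝ → Idx m → ℝ}
    (hy : ∀ s, HasDerivAt y (X.1 *ᵥ y s) s) (s : ℝ) : (expG (s • X)).mat *ᵥ y 0 = y s :=
  exp_smul_mulVec_of_hasDerivAt X.1 hy s

theorem expG_smul_eigenvector (X : LieG m) {v : Idx m → ℝ} {a : ℝ} (h : X.1 *ᵥ v = a • v) (s : ℝ) :
    (expG (s • X)).mat *ᵥ v = Real.exp (s * a) • v := by
  have hy : ∀ s, HasDerivAt (fun s : ℝ => Real.exp (s * a) • v)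
      (X.1 *ᵥ (Real.exp (s * a) • v)) s := by
    intro s
    rw [mulVec_smul, h, smul_smul]
    have := ((hasDerivAt_mul_const (x := s) a).exp).smul_const v
    simpa using this
  simpa using expG_smul_mulVec X hy s

/-- With `f` null and orthogonal to `w`, the cube of `rot f w` is zero, so the exponential series
stops at order two. -/
theorem expG_smul_rot (s : ℝ) {f w : Idx m → ℝ} (hf : bil m f f = 0) (hw : bil m f w = 0)
    (v : Idx m → ℝ) : (expG (s • rot f w)).mat *ᵥ v
      = v + (s * bil m f v) • w
        - (s * bil m w v + s ^ 2 / 2 * (bil m f v * bil m w w)) • f := by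
  have hw' : bil m w f = 0 := by rw [bil_comm, hw]
  have hy : ∀ s, HasDerivAt (fun s : ℝ => v + (s * bil m f v) • w
        - (s * bil m w v + s ^ 2 / 2 * (bil m f v * bil m w w)) • f)
      ((rot f w).1 *ᵥ (v + (s * bil m f v) • w
        - (s * bil m w v + s ^ 2 / 2 * (bil m f v * bil m w w)) • f)) s := by
    intro s
    have h1 := (hasDerivAt_mul_const (x := s) (bil m f v)).smul_const w
    have h2 := ((hasDerivAt_mul_const (x := s) (bil m w v)).add
      (((hasDerivAt_pow 2 s).div_const 2).mul_const (bil m f v * bil m w w))).smul_const f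
    refine ((h1.const_add v).sub h2).congr_deriv ?_
    rw [rot_mulVec]
    simp only [map_add, map_sub, map_smul, hf, hw, hw', smul_eq_mul]
    push_cast
    module
  simpa using expG_smul_mulVec (rot f w) hy s

theorem continuous_expG_smul (X : LieG m) : Continuous fun t : ℝ => expG (t • X) := by
  let i1 : NormedRing (Matrix (Idx m) (Idx m) ℝ) := Matrix.linftyOpNormedRing
  let i2 : NormedAlgebra ℝ (Matrix (Idx m) (Idx m) ℝ) := Matrix.linftyOpNormedAlgebra
  let i3 : NormedAlgebra ℚ (Matrix (Idx m) (Idx m) ℝ) := NormedAlgebra.restrictScalars ℚ ℝ _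
  have h1 : Continuous fun t : ℝ => t • (X : Matrix (Idx m) (Idx m) ℝ) := by fun_prop
  refine Continuous.subtype_mk (Continuous.subtype_mk (Units.continuous_iff.2 ⟨?_, ?_⟩) _) _
  · exact NormedSpace.exp_continuous.comp h1
  · exact NormedSpace.exp_continuous.comp h1.neg

/-! ### Coordinate vectors and null vectors -/

/-- The coordinate vector of the time coordinate `t`. -/
def et (m : ℕ) : Idx m → ℝ := Pi.single (Sum.inl 1) 1

/-- The coordinate vector of a space coordinate. -/
def ex (i : Fin (m + 2)) : Idx m → ℝ := Pi.single (Sum.inr i) 1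

theorem et_bil (v : Idx m → ℝ) : bil m (et m) v = v (Sum.inl 1) := by
  simp [bil_apply, et]

theorem ex_bil (i : Fin (m + 2)) (v : Idx m → ℝ) : bil m (ex i) v = -v (Sum.inr i) := by
  simp [bil_apply, ex, Pi.single_apply]

theorem rot_et_ex (i : Fin (m + 2)) : rot (et m) (ex i) = ⟨boostMat 1 i, boostMat_mem 1 i⟩ := by
  refine LieG.ext_mulVec fun v => ?_
  rw [rot_mulVec, et_bil, ex_bil]
  simp [boostMat, Matrix.add_mulVec, Matrix.single_mulVec, et, ex, funext_iff, Pi.single_apply,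
    Function.update_apply, add_comm]

theorem rot_e0_ex (i : Fin (m + 2)) : rot (e0 m) (ex i) = q i := by
  refine LieG.ext_mulVec fun v => ?_
  rw [rot_mulVec, e0_bil, ex_bil]
  simp [q, boostMat, Matrix.add_mulVec, Matrix.single_mulVec, e0, ex, funext_iff, Pi.single_apply,
    Function.update_apply, add_comm]

theorem rot_e0_et : rot (e0 m) (et m) = -q0 m := by
  refine LieG.ext_mulVec fun v => ?_
  rw [rot_mulVec, e0_bil, et_bil, LieG.neg_mulVec]
  simp [q0, rotMat, Matrix.sub_mulVec, Matrix.single_mulVec, e0, et, funext_iff, Pi.single_apply,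
    Function.update_apply]

theorem J1_eq_rot : J1 m = rot (et m) (ex 1) := (rot_et_ex 1).symm

theorem J2_eq_rot : J2 m = rot (e0 m) (ex 0) := (rot_e0_ex 0).symm

/-- The null vector `e_t + ε e_{x₂}`. -/
def nullF (m : ℕ) (ε : ℝ) : Idx m → ℝ := et m + ε • ex 1

/-- The null vector `e_u + ε e_{x₁}`. -/
def nullG (m : ℕ) (ε : ℝ) : Idx m → ℝ := e0 m + ε • ex 0

theorem nullF_bil (ε : ℝ) (v : Idx m → ℝ) :
    bil m (nullF m ε) v = v (Sum.inl 1) - ε * v (Sum.inr 1) := by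
  simp [nullF, et_bil, ex_bil, sub_eq_add_neg]

theorem nullG_bil (ε : ℝ) (v : Idx m → ℝ) :
    bil m (nullG m ε) v = v (Sum.inl 0) - ε * v (Sum.inr 0) := by
  simp [nullG, e0_bil, ex_bil, sub_eq_add_neg]

theorem nullF_inl_zero (ε : ℝ) : nullF m ε (Sum.inl 0) = 0 := by simp [nullF, et, ex]
theorem nullF_inl_one (ε : ℝ) : nullF m ε (Sum.inl 1) = 1 := by simp [nullF, et, ex]
theorem nullF_inr_zero (ε : ℝ) : nullF m ε (Sum.inr 0) = 0 := by simp [nullF, et, ex]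
theorem nullF_inr_one (ε : ℝ) : nullF m ε (Sum.inr 1) = ε := by simp [nullF, et, ex]
theorem nullG_inl_zero (ε : ℝ) : nullG m ε (Sum.inl 0) = 1 := by simp [nullG, e0, ex]
theorem nullG_inl_one (ε : ℝ) : nullG m ε (Sum.inl 1) = 0 := by simp [nullG, e0, ex]
theorem nullG_inr_zero (ε : ℝ) : nullG m ε (Sum.inr 0) = ε := by simp [nullG, e0, ex]
theorem nullG_inr_one (ε : ℝ) : nullG m ε (Sum.inr 1) = 0 := by simp [nullG, e0, ex]
theorem e0_inl_zero : e0 m (Sum.inl 0) = 1 := by simp [e0]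
theorem e0_inl_one : e0 m (Sum.inl 1) = 0 := by simp [e0]
theorem e0_inr (i : Fin (m + 2)) : e0 m (Sum.inr i) = 0 := by simp [e0]

theorem J1_nullF {ε : ℝ} (hε : ε * ε = 1) : (J1 m).1 *ᵥ nullF m ε = ε • nullF m ε := by
  rw [J1_eq_rot, rot_mulVec, et_bil, ex_bil, nullF_inl_one, nullF_inr_one, nullF, smul_add,
    smul_smul, hε]
  module

theorem J2_nullG {ε : ℝ} (hε : ε * ε = 1) : (J2 m).1 *ᵥ nullG m ε = ε • nullG m ε := by
  rw [J2_eq_rot, rot_mulVec, e0_bil, ex_bil, nullG_inl_zero, nullG_inr_zero, nullG, smul_add,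
    smul_smul, hε]
  module

theorem J1_nullG (ε : ℝ) : (J1 m).1 *ᵥ nullG m ε = 0 := by
  rw [J1_eq_rot, rot_mulVec, et_bil, ex_bil, nullG_inl_one, nullG_inr_one]
  module

theorem J2_nullF (ε : ℝ) : (J2 m).1 *ᵥ nullF m ε = 0 := by
  rw [J2_eq_rot, rot_mulVec, e0_bil, ex_bil, nullF_inl_zero, nullF_inr_zero]
  module

/-! ### Points of `AdS` as vectors -/

/-- The embedding `g H ↦ g e₀` of `AdS` into `ℝ^(2, l-1)`. -/
def vec (p : AdS m) : Idx m → ℝ :=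
  Quotient.liftOn' p (fun g : GroupG m => g.mat *ᵥ e0 m) fun a b hab => by
    have h : (a⁻¹ * b).mat *ᵥ e0 m = e0 m := QuotientGroup.leftRel_apply.1 hab
    change a.mat *ᵥ e0 m = b.mat *ᵥ e0 m
    conv_lhs => rw [← h]
    rw [← GroupG.mul_mulVec, mul_inv_cancel_left]

theorem vec_proj (g : GroupG m) : vec (proj g) = g.mat *ᵥ e0 m := rfl

/-- `H` is by definition the full stabilizer of `e₀` in `G`. -/
theorem vec_injective : Function.Injective (vec (m := m)) := by
  rintro ⟨a⟩ ⟨b⟩ (h : a.mat *ᵥ e0 m = b.mat *ᵥ e0 m)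
  refine QuotientGroup.eq.2 ?_
  change (a⁻¹ * b).mat *ᵥ e0 m = e0 m
  rw [GroupG.mul_mulVec]
  exact GroupG.inv_mulVec_eq h

theorem continuous_mat : Continuous (GroupG.mat (m := m)) :=
  Units.continuous_val.comp (continuous_subtype_val.comp continuous_subtype_val)

theorem continuous_vec : Continuous (vec (m := m)) :=
  Continuous.quotient_liftOn' (continuous_mat.matrix_mulVec continuous_const) _

theorem vec_smul (k : GroupG m) (p : AdS m) : vec (k • p) = k.mat *ᵥ vec p := by
  obtain ⟨g, rfl⟩ := QuotientGroup.mk_surjective p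
  exact GroupG.mul_mulVec k g (e0 m)

theorem bil_vec (p : AdS m) : bil m (vec p) (vec p) = 1 := by
  obtain ⟨g, rfl⟩ := QuotientGroup.mk_surjective p
  change bil m (g.mat *ᵥ e0 m) (g.mat *ᵥ e0 m) = 1
  rw [GroupG.bil_mat, e0_bil, e0_inl_zero]

/-! ### Orbits of subgroups of `G`, read on vectors -/

/-- Two vectors are in the same orbit of a subgroup of `G`. -/
def SameOrbit (K : Subgroup (GroupG m)) (v w : Idx m → ℝ) : Prop := ∃ k ∈ K, k.mat *ᵥ v = w

theorem SameOrbit.symm {K : Subgroup (GroupG m)} {v w : Idx m → ℝ} (h : SameOrbit K v w) :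
    SameOrbit K w v :=
  let ⟨k, hk, e⟩ := h
  ⟨k⁻¹, K.inv_mem hk, GroupG.inv_mulVec_eq e⟩

theorem SameOrbit.trans {K : Subgroup (GroupG m)} {v w z : Idx m → ℝ} (h : SameOrbit K v w)
    (h' : SameOrbit K w z) : SameOrbit K v z := by
  obtain ⟨k, hk, rfl⟩ := h
  obtain ⟨k', hk', rfl⟩ := h'
  exact ⟨k' * k, K.mul_mem hk' hk, GroupG.mul_mulVec _ _ _⟩

theorem SameOrbit.bil_self {K : Subgroup (GroupG m)} {v w : Idx m → ℝ} (h : SameOrbit K v w) :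
    bil m w w = bil m v v := by
  obtain ⟨k, -, rfl⟩ := h
  exact k.bil_mat v v

theorem mem_orbit_iff (K : Subgroup (GroupG m)) (p p' : AdS m) :
    p' ∈ MulAction.orbit K p ↔ SameOrbit K (vec p) (vec p') := by
  constructor
  · rintro ⟨k, rfl⟩
    exact ⟨k.1, k.2, (vec_smul k.1 p).symm⟩
  · rintro ⟨k, hk, h⟩
    exact ⟨⟨k, hk⟩, vec_injective ((vec_smul k p).trans h)⟩

theorem sameOrbit_exp {V : Submodule ℝ (LieG m)} {X : LieG m} (hX : X ∈ V) (s : ℝ)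
    (v : Idx m → ℝ) : SameOrbit (expSubgroup V) v ((expG (s • X)).mat *ᵥ v) :=
  ⟨_, Subgroup.subset_closure ⟨_, V.smul_mem s hX, rfl⟩, rfl⟩

/-! ### Closed orbits of the horospherical groups -/

/-- The properties of the Lie algebras of `AN` (`ε = 1`) and of `A N̄` (`ε = -1`) on which the
description of the closed orbits relies. -/
structure IsHorospherical (V : Submodule ℝ (LieG m)) (ε : ℝ) : Prop where
  sq_eq_one : ε * ε = 1
  exists_eigenvalue : ∀ X ∈ V, ∃ a : ℝ, X.1 *ᵥ nullF m ε = a • nullF m ε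
  rot_nullF_mem : ∀ w, bil m (nullF m ε) w = 0 → rot (nullF m ε) w ∈ V
  rot_nullG_mem : ∀ y, bil m (nullF m ε) y = 0 → bil m (nullF m (-ε)) y = 0 →
    bil m (nullG m ε) y = 0 → rot (nullG m ε) y ∈ V
  J1_mem : J1 m ∈ V
  J2_mem : J2 m ∈ V

namespace IsHorospherical

variable {V : Submodule ℝ (LieG m)} {ε : ℝ}

theorem nullF_nullF (h : IsHorospherical V ε) : bil m (nullF m ε) (nullF m ε) = 0 := by
  rw [nullF_bil, nullF_inl_one, nullF_inr_one, h.sq_eq_one, sub_self]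

theorem nullG_nullG (h : IsHorospherical V ε) : bil m (nullG m ε) (nullG m ε) = 0 := by
  rw [nullG_bil, nullG_inl_zero, nullG_inr_zero, h.sq_eq_one, sub_self]

theorem neg_mul_neg (h : IsHorospherical V ε) : -ε * -ε = 1 := by
  linear_combination h.sq_eq_one

/-- The generators, hence the whole group, preserve the line of the null vector; being isometries,
they preserve its orthogonal hyperplane. -/
theorem bil_nullF_eq_zero_of_sameOrbit (h : IsHorospherical V ε) {v w : Idx m → ℝ}
    (hvw : SameOrbit (expSubgroup V) v w) (hv : bil m (nullF m ε) v = 0) :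
    bil m (nullF m ε) w = 0 := by
  have key : ∀ k ∈ expSubgroup V, ∃ a : ℝ, k.mat *ᵥ nullF m ε = a • nullF m ε := by
    intro k hk
    induction hk using Subgroup.closure_induction with
    | mem k hk =>
      obtain ⟨X, hX, rfl⟩ := hk
      obtain ⟨a, ha⟩ := h.exists_eigenvalue X hX
      exact ⟨_, by simpa using expG_smul_eigenvector X ha 1⟩
    | one => exact ⟨1, by rw [GroupG.mat_one, one_mulVec, one_smul]⟩
    | mul k k' _ _ hk hk' =>
      obtain ⟨a, ha⟩ := hk
      obtain ⟨a', ha'⟩ := hk'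
      exact ⟨a' * a, by rw [GroupG.mul_mulVec, ha', mulVec_smul, ha, smul_smul]⟩
    | inv k _ hk =>
      obtain ⟨a, ha⟩ := hk
      have h1 := GroupG.inv_mulVec_eq ha
      have ha0 : a ≠ 0 := by
        rintro rfl
        rw [zero_smul, mulVec_zero] at h1
        have := congrFun h1 (Sum.inl 1)
        rw [nullF_inl_one] at this
        simp at this
      refine ⟨a⁻¹, ?_⟩
      rw [mulVec_smul] at h1
      rw [eq_inv_smul_iff₀ ha0, h1]
  obtain ⟨k, hk, rfl⟩ := hvw.symm
  obtain ⟨a, ha⟩ := key k hk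
  have h1 := k.bil_mat (nullF m ε) w
  rw [ha, map_smul, LinearMap.smul_apply, hv, smul_zero] at h1
  exact h1.symm

/-- A point off the null hyperplane can be moved to `e₀ + (b / 2) f'`. -/
theorem sameOrbit_of_ne_zero (h : IsHorospherical V ε) {v : Idx m → ℝ} (hv : bil m v v = 1)
    (hb : bil m (nullF m ε) v ≠ 0) : SameOrbit (expSubgroup V) v
      (e0 m + (bil m (nullF m ε) v / 2) • nullF m (-ε)) := by
  set b := bil m (nullF m ε) v with hbdef
  set z := e0 m + (b / 2) • nullF m (-ε) with hz
  have hff' : bil m (nullF m ε) (nullF m (-ε)) = 2 := by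
    rw [nullF_bil, nullF_inl_one, nullF_inr_one]
    linear_combination h.sq_eq_one
  have hf'f' : bil m (nullF m (-ε)) (nullF m (-ε)) = 0 := by
    rw [nullF_bil, nullF_inl_one, nullF_inr_one]
    linear_combination -h.sq_eq_one
  have hfe : ∀ δ, bil m (nullF m δ) (e0 m) = 0 := fun δ => by
    rw [nullF_bil, e0_inl_one, e0_inr]; ring
  have hfz : bil m (nullF m ε) z = b := by
    rw [hz, map_add, map_smul, hff', hfe, smul_eq_mul]; ring
  -- Since `v` pairs to `b` with `f`, the exponential attached to this vector displaces `v` by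
  -- exactly `z - v`, up to a multiple `τ` of `f`.
  have hw : bil m (nullF m ε) (b⁻¹ • (z - v)) = 0 := by
    rw [map_smul, map_sub, hfz, ← hbdef, sub_self, smul_zero]
  have hmove := sameOrbit_exp (h.rot_nullF_mem _ hw) 1 v
  rw [expG_smul_rot 1 h.nullF_nullF hw] at hmove
  set τ := 1 * bil m (b⁻¹ • (z - v)) v + 1 ^ 2 / 2 * (bil m (nullF m ε) v *
    bil m (b⁻¹ • (z - v)) (b⁻¹ • (z - v)))
  have e : v + (1 * bil m (nullF m ε) v) • b⁻¹ • (z - v) - τ • nullF m ε = z - τ • nullF m ε := by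
    rw [← hbdef, smul_smul, one_mul, mul_inv_cancel₀ hb]
    module
  rw [e] at hmove
  have hn := hmove.bil_self
  have hzz : bil m z z = 1 := by
    rw [hz]
    simp only [map_add, map_smul, LinearMap.add_apply, LinearMap.smul_apply, hf'f', hfe,
      bil_comm (e0 m), smul_eq_mul]
    rw [← bil_comm (e0 m) (e0 m), e0_bil, e0_inl_zero]
    ring
  rw [hv] at hn
  simp only [map_sub, map_smul, LinearMap.sub_apply, LinearMap.smul_apply, h.nullF_nullF, hzz,
    bil_comm z, hfz, smul_eq_mul] at hn
  -- Both `z` and `z - τ f` have norm 1, while `z` pairs to `b ≠ 0` with the null vector `f`.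
  have hτ : τ = 0 := by
    have : τ * b = 0 := by linarith
    exact (mul_eq_zero.1 this).resolve_right hb
  rwa [hτ, zero_smul, sub_zero] at hmove

/-- The flow of `J₁` fixes `e₀` and contracts the opposite null vector, so the normal form `e₀ + (b
/ 2) f'` tends to `e₀` inside the orbit. The limit is on the invariant hyperplane and the orbit is
not. -/
theorem not_isClosed_orbit (h : IsHorospherical V ε) {p : AdS m}
    (hb : bil m (nullF m ε) (vec p) ≠ 0) :
    ¬ IsClosed (MulAction.orbit (expSubgroup V) p) := by
  intro hcl
  set b := bil m (nullF m ε) (vec p) with hbdef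
  have hf' : bil m (nullF m (-ε)) (nullF m (-ε)) = 0 := by
    rw [nullF_bil, nullF_inl_one, nullF_inr_one]
    linear_combination -h.sq_eq_one
  have hf'e : bil m (nullF m (-ε)) (e0 m) = 0 := by
    rw [nullF_bil, e0_inl_one, e0_inr]; ring
  have h0 := h.sameOrbit_of_ne_zero (bil_vec p) hb
  rw [← hbdef] at h0
  -- This is the point with vector `e₀ + (b / 2) e⁻ⁿ f'`. Writing it with an exponential gives a
  -- continuous curve in `G`, so that convergence holds in the quotient and not only for the
  -- vectors.
  have hmem : ∀ n : ℕ, proj (expG ((-(b / 2 * Real.exp (-n))) • rot (nullF m (-ε)) (e0 m))) ∈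
      MulAction.orbit (expSubgroup V) p := by
    intro n
    rw [mem_orbit_iff]
    refine h0.trans ?_
    have h1 := sameOrbit_exp h.J1_mem (ε * n) (e0 m + (b / 2) • nullF m (-ε))
    have h2 : (J1 m).1 *ᵥ e0 m = (0 : ℝ) • e0 m := by
      rw [J1_eq_rot, rot_mulVec, et_bil, ex_bil, e0_inl_one, e0_inr]
      module
    rw [mulVec_add, mulVec_smul, expG_smul_eigenvector _ h2,
      expG_smul_eigenvector _ (J1_nullF h.neg_mul_neg)] at h1
    rw [vec_proj, expG_smul_rot _ hf' hf'e, hf'e, e0_bil, e0_inl_zero]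
    convert h1 using 1
    rw [show ε * n * -ε = -(n : ℝ) by linear_combination (-n : ℝ) * h.sq_eq_one, mul_zero (ε * n),
      Real.exp_zero]
    module
  have hlim : Filter.Tendsto (fun n : ℕ => proj (expG
      ((-(b / 2 * Real.exp (-n))) • rot (nullF m (-ε)) (e0 m)))) Filter.atTop
      (nhds (proj (expG ((-(b / 2 * 0) : ℝ) • rot (nullF m (-ε)) (e0 m))))) := by
    have hc : Continuous fun s : ℝ => proj (expG (s • rot (nullF m (-ε)) (e0 m))) :=
      continuous_quotient_mk'.comp (continuous_expG_smul _)
    refine (hc.tendsto _).comp (((Filter.Tendsto.const_mul _ ?_)).neg)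
    exact Real.tendsto_exp_neg_atTop_nhds_zero.comp tendsto_natCast_atTop_atTop
  have hlast := hcl.mem_of_tendsto hlim (Filter.Eventually.of_forall hmem)
  rw [mem_orbit_iff] at hlast
  refine hb (h.bil_nullF_eq_zero_of_sameOrbit hlast.symm ?_)
  rw [vec_proj, expG_smul_rot _ hf' hf'e]
  simp [nullF_bil, e0_inl_one, e0_inr]

/-- If both pairings vanished, then `t² = x₂²` and `u² = x₁²`, leaving only non-positive terms in
the norm. -/
theorem nullG_ne_zero {ε : ℝ} (hε : ε * ε = 1) {v : Idx m → ℝ} (hv : bil m v v = 1)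
    (hb : bil m (nullF m ε) v = 0) : bil m (nullG m ε) v ≠ 0 := by
  intro hc
  rw [nullF_bil] at hb
  rw [nullG_bil] at hc
  rw [bil_apply, Fin.sum_univ_succ, Fin.sum_univ_succ] at hv
  have hpos : 0 ≤ ∑ i : Fin m, v (Sum.inr i.succ.succ) * v (Sum.inr i.succ.succ) :=
    Finset.sum_nonneg fun i _ => mul_self_nonneg _
  have e1 : v (Sum.inl 0) * v (Sum.inl 0) = v (Sum.inr 0) * v (Sum.inr 0) := by
    rw [sub_eq_zero.1 hc]; linear_combination v (Sum.inr 0) * v (Sum.inr 0) * hε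
  have e2 : v (Sum.inl 1) * v (Sum.inl 1) = v (Sum.inr 1) * v (Sum.inr 1) := by
    rw [sub_eq_zero.1 hb]; linear_combination v (Sum.inr 1) * v (Sum.inr 1) * hε
  have e3 : (Fin.succ 0 : Fin (m + 2)) = 1 := rfl
  rw [e1, e2, e3] at hv
  linarith

/-- A point of the null hyperplane can be moved to `e₀` or `-e₀`. -/
theorem sameOrbit_of_eq_zero (h : IsHorospherical V ε) {v : Idx m → ℝ} (hv : bil m v v = 1)
    (hb : bil m (nullF m ε) v = 0) :
    SameOrbit (expSubgroup V) v (((SignType.sign (bil m (nullG m ε) v) : SignType) : ℝ) • e0 m) := by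
  set c := bil m (nullG m ε) v with hcdef
  have hc : c ≠ 0 := nullG_ne_zero h.sq_eq_one hv hb
  set σ : ℝ := ((SignType.sign c : SignType) : ℝ) with hσdef
  have hσ : σ * σ = 1 := by
    rw [hσdef, ← SignType.coe_mul]
    rcases lt_or_gt_of_ne hc with h1 | h1
    · simp [sign_neg h1]
    · simp [sign_pos h1]
  have hσc : σ * |c| = c := by rw [hσdef]; exact sign_mul_abs c
  have hge : bil m (nullG m ε) (e0 m) = 1 := by rw [nullG_bil, e0_inl_zero, e0_inr]; ring
  have hfe : ∀ δ, bil m (nullF m δ) (e0 m) = 0 := fun δ => by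
    rw [nullF_bil, e0_inl_one, e0_inr]; ring
  have hff' : bil m (nullF m (-ε)) (nullF m ε) = 2 := by
    rw [nullF_bil, nullF_inl_one, nullF_inr_one]
    linear_combination h.sq_eq_one
  have hgf : bil m (nullG m ε) (nullF m ε) = 0 := by
    rw [nullG_bil, nullF_inl_zero, nullF_inr_zero]; ring
  have hee : bil m (e0 m) (e0 m) = 1 := by rw [e0_bil, e0_inl_zero]
  -- normalize the component along `g`
  obtain ⟨v', hvv', hc'⟩ : ∃ v', SameOrbit (expSubgroup V) v v' ∧ bil m (nullG m ε) v' = σ := by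
    -- At this time the flow of `J₂` multiplies `g` by `|c|`; as it is an isometry, the pairing with
    -- `g` is divided by `|c|`.
    refine ⟨_, sameOrbit_exp h.J2_mem (ε * Real.log |c|) v, ?_⟩
    have h1 := (expG ((ε * Real.log |c|) • J2 m)).bil_mat (nullG m ε) v
    rw [expG_smul_eigenvector _ (J2_nullG h.sq_eq_one), map_smul, LinearMap.smul_apply,
      show ε * Real.log |c| * ε = Real.log |c| by linear_combination Real.log |c| * h.sq_eq_one,
      Real.exp_log (abs_pos.2 hc), ← hcdef, smul_eq_mul] at h1
    exact mul_left_cancel₀ (abs_ne_zero.2 hc) (h1.trans (by rw [mul_comm, hσc]))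
  have hb' := h.bil_nullF_eq_zero_of_sameOrbit hvv' hb
  have hv' := hvv'.bil_self.trans hv
  refine hvv'.trans ?_
  clear_value σ
  -- remove the transverse components
  set κ := bil m (nullF m (-ε)) (σ • e0 m - v') / 2 with hκ
  set d := σ • e0 m - v' - κ • nullF m ε with hd
  -- The choice of `κ` makes `d` orthogonal to the opposite null vector too. The factor `σ`
  -- compensates the pairing `σ` of `v'` with `g`, as `σ² = 1`.
  have hfd : bil m (nullF m ε) (σ • d) = 0 := by
    rw [hd]; simp only [map_sub, map_smul, hfe, hb', h.nullF_nullF]; simp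
  have hf'd : bil m (nullF m (-ε)) (σ • d) = 0 := by
    rw [hd, map_smul, map_sub, map_smul _ κ, hff', hκ, smul_eq_mul, smul_eq_mul]; ring
  have hgd : bil m (nullG m ε) (σ • d) = 0 := by
    rw [hd]; simp only [map_sub, map_smul, hge, hc', hgf]; simp
  have hmove := sameOrbit_exp (h.rot_nullG_mem _ hfd hf'd hgd) 1 v'
  rw [expG_smul_rot 1 h.nullG_nullG hgd, hc'] at hmove
  set τ := 1 * bil m (σ • d) v' + 1 ^ 2 / 2 * (σ * bil m (σ • d) (σ • d))
  have e : v' + (1 * σ) • σ • d - τ • nullG m ε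
      = σ • e0 m - κ • nullF m ε - τ • nullG m ε := by
    rw [smul_smul, one_mul, hσ, hd]
    module
  rw [e] at hmove
  have hn := hmove.bil_self
  rw [hv'] at hn
  have hτ : τ = 0 := by
    simp only [map_sub, map_smul, LinearMap.sub_apply, LinearMap.smul_apply, h.nullF_nullF,
      h.nullG_nullG, bil_comm (e0 m) (nullF m ε), bil_comm (e0 m) (nullG m ε), hfe, hge, hee,
      bil_comm (nullF m ε) (nullG m ε), hgf, smul_eq_mul] at hn
    have : τ * σ = 0 := by linarith
    have hσ0 : σ ≠ 0 := by rintro rfl; simp at hσ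
    exact (mul_eq_zero.1 this).resolve_right hσ0
  rw [hτ, zero_smul, sub_zero] at hmove
  refine hmove.trans ?_
  -- remove the component along `f`
  have hw : bil m (nullF m ε) ((-(κ * σ)) • e0 m) = 0 := by rw [map_smul, hfe, smul_zero]
  have hlast := sameOrbit_exp (h.rot_nullF_mem _ hw) 1 (σ • e0 m - κ • nullF m ε)
  rw [expG_smul_rot 1 h.nullF_nullF hw] at hlast
  convert hlast using 1
  simp only [map_sub, map_smul, LinearMap.smul_apply, hfe, h.nullF_nullF, hee,
    bil_comm (e0 m) (nullF m ε), smul_eq_mul, mul_zero, zero_mul, sub_zero, zero_smul, add_zero,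
    mul_one, one_mul]
  rw [sub_sub, ← add_smul, show κ + σ * -(κ * σ) = 0 by linear_combination -κ * hσ]
  module

/-- On the hyperplane section, points with the same sign of the pairing with `g` share an orbit, by
the normal form `±e₀`. So the orbit is the whole section or one half. Both cases are closed, and
there is no need to know which one occurs. -/
theorem isClosed_orbit (h : IsHorospherical V ε) {p : AdS m}
    (hb : bil m (nullF m ε) (vec p) = 0) : IsClosed (MulAction.orbit (expSubgroup V) p) := by
  have hlin : ∀ v : Idx m → ℝ, Continuous fun p : AdS m => bil m v (vec p) := fun v =>
    (LinearMap.continuous_of_finiteDimensional (bil m v)).comp continuous_vec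
  have hp := h.sameOrbit_of_eq_zero (bil_vec p) hb
  have hsub : ∀ p', p' ∈ MulAction.orbit (expSubgroup V) p → bil m (nullF m ε) (vec p') = 0 :=
    fun p' hp' => h.bil_nullF_eq_zero_of_sameOrbit ((mem_orbit_iff _ _ _).1 hp') hb
  have hsame : ∀ p', bil m (nullF m ε) (vec p') = 0 → ∀ p'' ∈ MulAction.orbit (expSubgroup V) p,
      SignType.sign (bil m (nullG m ε) (vec p')) = SignType.sign (bil m (nullG m ε) (vec p'')) →
      p' ∈ MulAction.orbit (expSubgroup V) p := by
    intro p' hp' p'' hp'' hs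
    have h1 := h.sameOrbit_of_eq_zero (bil_vec p') hp'
    have h2 := h.sameOrbit_of_eq_zero (bil_vec p'') (hsub _ hp'')
    rw [hs] at h1
    exact (mem_orbit_iff _ _ _).2 (((mem_orbit_iff _ _ _).1 hp'').trans (h2.trans h1.symm))
  by_cases hall : ∃ p' ∈ MulAction.orbit (expSubgroup V) p,
      SignType.sign (bil m (nullG m ε) (vec p')) ≠ SignType.sign (bil m (nullG m ε) (vec p))
  · obtain ⟨p', hp', hne⟩ := hall
    have : MulAction.orbit (expSubgroup V) p = {r | bil m (nullF m ε) (vec r) = 0} := by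
      refine Set.Subset.antisymm hsub fun r hr => ?_
      have n0 := sign_ne_zero.2 (nullG_ne_zero h.sq_eq_one (bil_vec r) hr)
      have n1 := sign_ne_zero.2 (nullG_ne_zero h.sq_eq_one (bil_vec p') (hsub _ hp'))
      have n2 := sign_ne_zero.2 (nullG_ne_zero h.sq_eq_one (bil_vec p) hb)
      -- Three non-zero signs, two of which differ: the third equals one of them.
      by_cases h1 : SignType.sign (bil m (nullG m ε) (vec r))
          = SignType.sign (bil m (nullG m ε) (vec p))
      · exact hsame r hr p (MulAction.mem_orbit_self p) h1
      · refine hsame r hr p' hp' ?_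
        revert n0 n1 n2 h1 hne
        generalize SignType.sign (bil m (nullG m ε) (vec r)) = a
        generalize SignType.sign (bil m (nullG m ε) (vec p)) = b
        generalize SignType.sign (bil m (nullG m ε) (vec p')) = c
        revert a b c
        decide
    rw [this]
    exact isClosed_singleton.preimage (hlin _)
  · push Not at hall
    -- The pairing with `g` never vanishes on the section, so a non-strict inequality already
    -- describes the half.
    have : MulAction.orbit (expSubgroup V) p = {r | bil m (nullF m ε) (vec r) = 0} ∩
        {r | 0 ≤ bil m (nullG m ε) (vec p) * bil m (nullG m ε) (vec r)} := by
      refine Set.Subset.antisymm (fun r hr => ⟨hsub r hr, ?_⟩) ?_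
      · have := hall r hr
        have h3 := congrArg (SignType.sign (bil m (nullG m ε) (vec p)) * ·) this
        simp only [← sign_mul] at h3
        have h4 : (0 : ℝ) ≤ bil m (nullG m ε) (vec p) * bil m (nullG m ε) (vec p) :=
          mul_self_nonneg _
        exact sign_nonneg_iff.1 (h3 ▸ sign_nonneg_iff.2 h4)
      · rintro r ⟨hr, hr'⟩
        refine hsame r hr p (MulAction.mem_orbit_self p) ?_
        have n0 := nullG_ne_zero h.sq_eq_one (bil_vec r) hr
        have n2 := nullG_ne_zero h.sq_eq_one (bil_vec p) hb
        have h5 := lt_of_le_of_ne hr' (mul_ne_zero n2 n0).symm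
        rcases pos_and_pos_or_neg_and_neg_of_mul_pos h5 with h6 | h6
        · rw [sign_pos h6.1, sign_pos h6.2]
        · rw [sign_neg h6.1, sign_neg h6.2]
    rw [this]
    exact (isClosed_singleton.preimage (hlin _)).inter
      (isClosed_Ici.preimage (continuous_const.mul (hlin _)))

theorem isClosed_orbit_iff (h : IsHorospherical V ε) (p : AdS m) :
    IsClosed (MulAction.orbit (expSubgroup V) p) ↔ bil m (nullF m ε) (vec p) = 0 :=
  ⟨fun hc => by_contra fun hb => h.not_isClosed_orbit hb hc, h.isClosed_orbit⟩

end IsHorospherical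

/-! ### The Cartan involution -/

theorem etaMat_mulVec_etaMat_mulVec (v : Idx m → ℝ) : etaMat m *ᵥ (etaMat m *ᵥ v) = v := by
  rw [mulVec_mulVec, etaMat_mul_self, one_mulVec]

theorem bil_etaMat_left (v w : Idx m → ℝ) : bil m (etaMat m *ᵥ v) w = bil m v (etaMat m *ᵥ w) := by
  simp [bil_apply, etaMat_mulVec_inl, etaMat_mulVec_inr]

/-- On this Lie algebra `-Xᵀ = η X η`, so `θ` is induced by the map `η` of the ambient space, which
exchanges the null vectors of parameters `ε` and `-ε`. -/
theorem theta_mulVec (X : LieG m) (v : Idx m → ℝ) :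
    (theta m X).1 *ᵥ v = etaMat m *ᵥ (X.1 *ᵥ (etaMat m *ᵥ v)) := by
  have h := (mem_so'_iff _).1 X.2
  have h2 : -(X.1)ᵀ = etaMat m * X.1 * etaMat m := by
    rw [← neg_eq_iff_eq_neg.2 h, Matrix.neg_mul, Matrix.mul_assoc, etaMat_mul_self, Matrix.mul_one]
  change (-(X.1)ᵀ) *ᵥ v = _
  rw [h2, mulVec_mulVec, mulVec_mulVec]

theorem theta_rot (f w : Idx m → ℝ) :
    theta m (rot f w) = rot (etaMat m *ᵥ f) (etaMat m *ᵥ w) := by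
  refine LieG.ext_mulVec fun v => ?_
  rw [theta_mulVec, rot_mulVec, rot_mulVec, bil_etaMat_left, bil_etaMat_left, mulVec_sub,
    mulVec_smul, mulVec_smul]

theorem etaMat_et : etaMat m *ᵥ et m = et m := by
  ext (i | i)
  · rw [etaMat_mulVec_inl]
  · rw [etaMat_mulVec_inr]; simp [et]

theorem etaMat_e0 : etaMat m *ᵥ e0 m = e0 m := by
  ext (i | i)
  · rw [etaMat_mulVec_inl]
  · rw [etaMat_mulVec_inr]; simp [e0]

theorem etaMat_ex (i : Fin (m + 2)) : etaMat m *ᵥ ex i = -ex i := by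
  ext (j | j)
  · rw [etaMat_mulVec_inl]; simp [ex]
  · rw [etaMat_mulVec_inr]; rfl

theorem etaMat_nullF (ε : ℝ) : etaMat m *ᵥ nullF m ε = nullF m (-ε) := by
  rw [nullF, mulVec_add, mulVec_smul, etaMat_et, etaMat_ex, nullF, smul_neg, neg_smul]

theorem etaMat_nullG (ε : ℝ) : etaMat m *ᵥ nullG m ε = nullG m (-ε) := by
  rw [nullG, mulVec_add, mulVec_smul, etaMat_e0, etaMat_ex, nullG, smul_neg, neg_smul]

/-! ### Root spaces -/

theorem mem_rootSpace {α β : ℝ} {X : LieG m} :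
    X ∈ rootSpace m α β ↔ ⁅J1 m, X⁆ = α • X ∧ ⁅J2 m, X⁆ = β • X := by
  rw [rootSpace, Submodule.mem_inf, Module.End.mem_eigenspace_iff, Module.End.mem_eigenspace_iff,
    LieAlgebra.ad_apply, LieAlgebra.ad_apply]

/-- By the derivation rule, weights add. Root vectors are thus built from weight vectors of the
ambient space. -/
theorem rot_mem_rootSpace {a b : Idx m → ℝ} {α α' β β' : ℝ} (h1 : (J1 m).1 *ᵥ a = α • a)
    (h1' : (J1 m).1 *ᵥ b = α' • b) (h2 : (J2 m).1 *ᵥ a = β • a) (h2' : (J2 m).1 *ᵥ b = β' • b) :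
    rot a b ∈ rootSpace m (α + α') (β + β') := by
  rw [mem_rootSpace, lie_rot, lie_rot, h1, h1', h2, h2']
  constructor <;>
  · rw [rot_smul, rot_swap (_ • a) b, rot_smul, rot_swap b a, add_smul, smul_neg, neg_neg]

theorem J1_mulVec_eq_zero {v : Idx m → ℝ} (h : v (Sum.inl 1) = 0) (h' : v (Sum.inr 1) = 0) :
    (J1 m).1 *ᵥ v = (0 : ℝ) • v := by
  rw [J1_eq_rot, rot_mulVec, et_bil, ex_bil, h, h']
  module

theorem J2_mulVec_eq_zero {v : Idx m → ℝ} (h : v (Sum.inl 0) = 0) (h' : v (Sum.inr 0) = 0) :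
    (J2 m).1 *ᵥ v = (0 : ℝ) • v := by
  rw [J2_eq_rot, rot_mulVec, e0_bil, ex_bil, h, h']
  module

/-- The image of `f` would have weight `(1 + α, β)`. The weight 2 does not occur for `J₁`, and a
vector with non-zero `J₂`-weight has no `t` and `x₂` components, so `J₁` kills it. -/
theorem rootSpace_nullF {α β : ℝ} (hα : 1 + α ≠ 0) (hαβ : α = 1 ∨ β ≠ 0) {X : LieG m}
    (hX : X ∈ rootSpace m α β) : X.1 *ᵥ nullF m 1 = 0 := by
  obtain ⟨h1, h2⟩ := mem_rootSpace.1 hX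
  set z := X.1 *ᵥ nullF m 1 with hz
  have e1 : (J1 m).1 *ᵥ z = (1 + α) • z := by
    have h := LieG.lie_mulVec (J1 m) X (nullF m 1)
    rw [h1, LieG.smul_mulVec, J1_nullF (one_mul 1), one_smul, ← hz] at h
    rw [add_smul, h]
    module
  have e2 : (J2 m).1 *ᵥ z = β • z := by
    have h := LieG.lie_mulVec (J2 m) X (nullF m 1)
    rw [h2, LieG.smul_mulVec, J2_nullF, mulVec_zero, ← hz, sub_zero] at h
    exact h.symm
  rw [J1_eq_rot, rot_mulVec, et_bil, ex_bil] at e1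
  rw [J2_eq_rot, rot_mulVec, e0_bil, ex_bil] at e2
  have a1 := congrFun e1 (Sum.inl 1)
  have a2 := congrFun e1 (Sum.inr 1)
  have a3 := congrFun e2 (Sum.inl 1)
  have a4 := congrFun e2 (Sum.inr 1)
  simp [et, ex] at a1 a2
  simp [e0, ex] at a3 a4
  have hz0 : z (Sum.inl 1) = 0 ∧ z (Sum.inr 1) = 0 := by
    rcases hαβ with rfl | hβ
    · constructor <;> linarith
    · exact ⟨a3.resolve_left hβ, a4.resolve_left hβ⟩
  rw [hz0.1, hz0.2] at e1
  have e3 : (1 + α) • z = 0 := by rw [← e1]; module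
  exact (smul_eq_zero.1 e3).resolve_left hα

theorem spaceN_nullF {X : LieG m} (hX : X ∈ spaceN m) : X.1 *ᵥ nullF m 1 = 0 := by
  let K : Submodule ℝ (LieG m) :=
    { carrier := {X | X.1 *ᵥ nullF m 1 = 0}
      zero_mem' := Matrix.zero_mulVec _
      add_mem' := fun {X Y} (hX : X.1 *ᵥ _ = 0) (hY : Y.1 *ᵥ _ = 0) => by
        change (X + Y).1 *ᵥ nullF m 1 = 0
        rw [LieG.add_mulVec, hX, hY, add_zero]
      smul_mem' := fun c X (hX : X.1 *ᵥ _ = 0) => by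
        change (c • X).1 *ᵥ nullF m 1 = 0
        rw [LieG.smul_mulVec, hX, smul_zero] }
  have hle : spaceN m ≤ K :=
    sup_le (sup_le (sup_le
      (fun X hX => rootSpace_nullF (by norm_num) (Or.inl rfl) hX)
      (fun X hX => rootSpace_nullF (by norm_num) (Or.inr one_ne_zero) hX))
      (fun X hX => rootSpace_nullF (by norm_num) (Or.inl rfl) hX))
      (fun X hX => rootSpace_nullF (by norm_num) (Or.inl rfl) hX)
  exact hle hX

theorem rootSpace_le_spaceN_10 : rootSpace m 1 0 ≤ spaceN m :=
  le_sup_left.trans (le_sup_left.trans le_sup_left)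

theorem rootSpace_le_spaceN_01 : rootSpace m 0 1 ≤ spaceN m :=
  le_sup_right.trans (le_sup_left.trans le_sup_left)

theorem rootSpace_le_spaceN_11 : rootSpace m 1 1 ≤ spaceN m :=
  le_sup_right.trans le_sup_left

theorem rootSpace_le_spaceN_1_neg : rootSpace m 1 (-1) ≤ spaceN m := le_sup_right

/-- Decompose `w` into weight vectors. Orthogonality to `f` excludes the opposite null vector, the
component along `f` contributes nothing, and the others give the roots `(1,0)`, `(1,1)`, `(1,-1)`.
The coefficients are halved because opposite null vectors pair to 2. -/
theorem rot_nullF_mem_spaceN {w : Idx m → ℝ} (hw : bil m (nullF m 1) w = 0) :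
    rot (nullF m 1) w ∈ spaceN m := by
  set κ := bil m (nullF m (-1)) w / 2 with hκ
  set α := bil m (nullG m (-1)) w / 2 with hα
  set α' := bil m (nullG m 1) w / 2 with hα'
  set y := w - κ • nullF m 1 - α • nullG m 1 - α' • nullG m (-1) with hy
  have e : w = y + κ • nullF m 1 + α • nullG m 1 + α' • nullG m (-1) := by rw [hy]; module
  have hy' : ∀ i, y i = w i - κ * nullF m 1 i - α * nullG m 1 i - α' * nullG m (-1) i :=
    fun i => rfl
  rw [nullF_bil] at hw hκ
  rw [nullG_bil] at hα hα'
  have y1 : y (Sum.inl 1) = 0 := by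
    rw [hy', nullF_inl_one, nullG_inl_one, nullG_inl_one]; linarith
  have y2 : y (Sum.inr 1) = 0 := by
    rw [hy', nullF_inr_one, nullG_inr_one, nullG_inr_one]; linarith
  have y3 : y (Sum.inl 0) = 0 := by
    rw [hy', nullF_inl_zero, nullG_inl_zero, nullG_inl_zero]; linarith
  have y4 : y (Sum.inr 0) = 0 := by
    rw [hy', nullF_inr_zero, nullG_inr_zero, nullG_inr_zero]; linarith
  have f1 := J1_nullF (m := m) (one_mul (1 : ℝ))
  have f2 : (J2 m).1 *ᵥ nullF m 1 = (0 : ℝ) • nullF m 1 := by rw [J2_nullF, zero_smul]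
  have g1 : ∀ ε, (J1 m).1 *ᵥ nullG m ε = (0 : ℝ) • nullG m ε := fun ε => by
    rw [J1_nullG, zero_smul]
  have g2 : ∀ {ε : ℝ}, ε * ε = 1 → (J2 m).1 *ᵥ nullG m ε = ε • nullG m ε := fun h => J2_nullG h
  have r1 := rot_mem_rootSpace f1 (J1_mulVec_eq_zero y1 y2) f2 (J2_mulVec_eq_zero y3 y4)
  have r2 := rot_mem_rootSpace f1 (g1 1) f2 (g2 (one_mul 1))
  have r3 := rot_mem_rootSpace f1 (g1 (-1)) f2 (g2 (by norm_num))
  rw [add_zero, zero_add] at r2 r3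
  rw [add_zero, zero_add] at r1
  rw [e, rot_add, rot_add, rot_add, rot_smul, rot_smul, rot_smul, rot_self, smul_zero, add_zero]
  exact add_mem (add_mem (rootSpace_le_spaceN_10 r1)
    (Submodule.smul_mem _ _ (rootSpace_le_spaceN_11 r2)))
    (Submodule.smul_mem _ _ (rootSpace_le_spaceN_1_neg r3))

theorem rot_nullG_mem_spaceN {w : Idx m → ℝ} (hf : bil m (nullF m 1) w = 0)
    (hf' : bil m (nullF m (-1)) w = 0) (hg : bil m (nullG m 1) w = 0) :
    rot (nullG m 1) w ∈ spaceN m := by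
  set α := bil m (nullG m (-1)) w / 2 with hα
  set y := w - α • nullG m 1 with hy
  have e : w = y + α • nullG m 1 := by rw [hy]; module
  have hy' : ∀ i, y i = w i - α * nullG m 1 i := fun i => rfl
  rw [nullF_bil] at hf hf'
  rw [nullG_bil] at hα hg
  have y1 : y (Sum.inl 1) = 0 := by
    rw [hy', nullG_inl_one]; linarith
  have y2 : y (Sum.inr 1) = 0 := by
    rw [hy', nullG_inr_one]; linarith
  have y3 : y (Sum.inl 0) = 0 := by
    rw [hy', nullG_inl_zero]; linarith
  have y4 : y (Sum.inr 0) = 0 := by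
    rw [hy', nullG_inr_zero]; linarith
  have g1 : (J1 m).1 *ᵥ nullG m 1 = (0 : ℝ) • nullG m 1 := by rw [J1_nullG, zero_smul]
  have r1 := rot_mem_rootSpace g1 (J1_mulVec_eq_zero y1 y2) (J2_nullG (one_mul 1))
    (J2_mulVec_eq_zero y3 y4)
  rw [add_zero, add_zero] at r1
  rw [e, rot_add, rot_smul, rot_self, smul_zero, add_zero]
  exact rootSpace_le_spaceN_01 r1

theorem spaceA_nullF {ε : ℝ} (hε : ε * ε = 1) {X : LieG m} (hX : X ∈ spaceA m) :
    ∃ a : ℝ, X.1 *ᵥ nullF m ε = a • nullF m ε := by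
  obtain ⟨a, b, rfl⟩ := Submodule.mem_span_pair.1 hX
  refine ⟨a * ε, ?_⟩
  rw [LieG.add_mulVec, LieG.smul_mulVec, LieG.smul_mulVec, J1_nullF hε, J2_nullF, smul_zero,
    add_zero, smul_smul]

theorem J1_mem_spaceA : J1 m ∈ spaceA m := Submodule.subset_span (by simp)

theorem J2_mem_spaceA : J2 m ∈ spaceA m := Submodule.subset_span (by simp)

theorem isHorospherical_AN : IsHorospherical (spaceA m ⊔ spaceN m) 1 where
  sq_eq_one := one_mul 1
  exists_eigenvalue X hX := by
    obtain ⟨Y, hY, Z, hZ, rfl⟩ := Submodule.mem_sup.1 hX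
    obtain ⟨a, ha⟩ := spaceA_nullF (one_mul 1) hY
    exact ⟨a, by rw [LieG.add_mulVec, ha, spaceN_nullF hZ, add_zero]⟩
  rot_nullF_mem w hw := Submodule.mem_sup_right (rot_nullF_mem_spaceN hw)
  rot_nullG_mem y h1 h2 h3 := Submodule.mem_sup_right (rot_nullG_mem_spaceN h1 h2 h3)
  J1_mem := Submodule.mem_sup_left J1_mem_spaceA
  J2_mem := Submodule.mem_sup_left J2_mem_spaceA

theorem isHorospherical_ANbar : IsHorospherical (spaceA m ⊔ spaceNbar m) (-1) where
  sq_eq_one := by norm_num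
  exists_eigenvalue X hX := by
    obtain ⟨Y, hY, Z, ⟨W, hW, rfl⟩, rfl⟩ := Submodule.mem_sup.1 hX
    obtain ⟨a, ha⟩ := spaceA_nullF (ε := -1) (by norm_num) hY
    exact ⟨a, by rw [LieG.add_mulVec, ha, theta_mulVec, etaMat_nullF, neg_neg, spaceN_nullF hW,
      mulVec_zero, add_zero]⟩
  rot_nullF_mem w hw := by
    refine Submodule.mem_sup_right ⟨rot (nullF m 1) (etaMat m *ᵥ w), rot_nullF_mem_spaceN ?_, ?_⟩
    · rw [← bil_etaMat_left, etaMat_nullF, hw]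
    · rw [theta_rot, etaMat_nullF, etaMat_mulVec_etaMat_mulVec]
  rot_nullG_mem w h1 h2 h3 := by
    rw [neg_neg] at h2
    refine Submodule.mem_sup_right ⟨rot (nullG m 1) (etaMat m *ᵥ w),
      rot_nullG_mem_spaceN ?_ ?_ ?_, ?_⟩
    · rw [← bil_etaMat_left, etaMat_nullF, h1]
    · rw [← bil_etaMat_left, etaMat_nullF, neg_neg, h2]
    · rw [← bil_etaMat_left, etaMat_nullG, h3]
    · rw [theta_rot, etaMat_nullG, etaMat_mulVec_etaMat_mulVec]
  J1_mem := Submodule.mem_sup_left J1_mem_spaceA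
  J2_mem := Submodule.mem_sup_left J2_mem_spaceA

/-- The singularity is the intersection of `AdS` with the cone `t² = x₂²`. -/
theorem mem_singularity_iff (p : AdS m) :
    p ∈ singularity m ↔ vec p (Sum.inl 1) ^ 2 - vec p (Sum.inr 1) ^ 2 = 0 := by
  refine (or_congr (isHorospherical_AN.isClosed_orbit_iff p)
    (isHorospherical_ANbar.isClosed_orbit_iff p)).trans ?_
  rw [nullF_bil, nullF_bil, ← mul_eq_zero]
  ring_nf

/-! ### Light-like geodesics -/

/-- The velocity `-e_t + ∑ w_i e_{x_i}` of the geodesic in the direction `E(w)`. -/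
def lightVec (w : EuclideanSpace ℝ (Fin (m + 2))) : Idx m → ℝ := ∑ i, w i • ex i - et m

theorem E_eq_rot (w : EuclideanSpace ℝ (Fin (m + 2))) : E w = rot (e0 m) (lightVec w) := by
  have hs : rot (e0 m) (∑ i, w i • ex i) = ∑ i, rot (e0 m) (w i • ex i) :=
    map_sum (AddMonoidHom.mk' (rot (e0 m)) (rot_add _)) _ _
  rw [lightVec, sub_eq_add_neg, rot_add, hs, ← neg_one_smul ℝ (et m), rot_smul, rot_e0_et, E,
    add_comm]
  simp [rot_smul, rot_e0_ex]

theorem lightVec_inl_zero (w : EuclideanSpace ℝ (Fin (m + 2))) : lightVec w (Sum.inl 0) = 0 := by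
  simp [lightVec, ex, et]

theorem lightVec_inl_one (w : EuclideanSpace ℝ (Fin (m + 2))) : lightVec w (Sum.inl 1) = -1 := by
  simp [lightVec, ex, et]

theorem lightVec_inr (w : EuclideanSpace ℝ (Fin (m + 2))) (i : Fin (m + 2)) :
    lightVec w (Sum.inr i) = w i := by
  simp [lightVec, ex, et, Pi.single_apply]

theorem sum_sq_eq_one {w : EuclideanSpace ℝ (Fin (m + 2))} (hw : ‖w‖ = 1) :
    ∑ i, w i * w i = 1 := by
  have h := EuclideanSpace.real_norm_sq_eq w
  rw [hw, one_pow] at h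
  simpa [sq] using h.symm

theorem bil_lightVec {w : EuclideanSpace ℝ (Fin (m + 2))} (hw : ‖w‖ = 1) :
    bil m (lightVec w) (lightVec w) = 0 := by
  rw [bil_apply, lightVec_inl_zero, lightVec_inl_one]
  simp only [lightVec_inr, sum_sq_eq_one hw]
  norm_num

/-- For a null direction orthogonal to `e₀` the quadratic term of the exponential vanishes on `e₀`:
the geodesic is a straight line. -/
theorem vec_geodesic (g : GroupG m) {n : Idx m → ℝ} (hn : bil m n n = 0)
    (h0 : n (Sum.inl 0) = 0) (s : ℝ) :
    vec (geodesic g (rot (e0 m) n) s) = g.mat *ᵥ (e0 m + s • n) := by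
  have h0' : bil m n (e0 m) = 0 := by rw [bil_comm, e0_bil, h0]
  rw [geodesic, vec_proj, GroupG.mul_mulVec, rot_swap, smul_neg, ← neg_smul,
    expG_smul_rot _ hn h0', h0', e0_bil, e0_inl_zero]
  congr 1
  module

theorem circlePt_mulVec (x : ℝ) (v : Idx m → ℝ) : (circlePt m x).mat *ᵥ v = v
    + ((Real.cos x - 1) * v (Sum.inl 0) - Real.sin x * v (Sum.inl 1)) • e0 m
    + (Real.sin x * v (Sum.inl 0) + (Real.cos x - 1) * v (Sum.inl 1)) • et m := by
  have hc : circlePt m x = expG (x • rot (e0 m) (et m)) := by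
    rw [circlePt, rot_e0_et, smul_neg]
  have hy : ∀ x : ℝ, HasDerivAt (fun x : ℝ => v
      + ((Real.cos x - 1) * v (Sum.inl 0) - Real.sin x * v (Sum.inl 1)) • e0 m
      + (Real.sin x * v (Sum.inl 0) + (Real.cos x - 1) * v (Sum.inl 1)) • et m)
      ((rot (e0 m) (et m)).1 *ᵥ (v
      + ((Real.cos x - 1) * v (Sum.inl 0) - Real.sin x * v (Sum.inl 1)) • e0 m
      + (Real.sin x * v (Sum.inl 0) + (Real.cos x - 1) * v (Sum.inl 1)) • et m)) x := by
    intro x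
    have hcos := ((Real.hasDerivAt_cos x).sub_const 1)
    have hsin := (Real.hasDerivAt_sin x)
    have h1 := ((hcos.mul_const (v (Sum.inl 0))).sub
      (hsin.mul_const (v (Sum.inl 1)))).smul_const (e0 m)
    have h2 := ((hsin.mul_const (v (Sum.inl 0))).add
      (hcos.mul_const (v (Sum.inl 1)))).smul_const (et m)
    refine ((h1.const_add v).add h2).congr_deriv ?_
    rw [rot_mulVec, e0_bil, et_bil]
    simp only [Pi.add_apply, Pi.smul_apply, smul_eq_mul, e0_inl_zero, e0_inl_one,
      show et m (Sum.inl 0) = 0 by simp [et], show et m (Sum.inl 1) = 1 by simp [et]]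
    module
  have h := expG_smul_mulVec _ hy x
  rw [← hc] at h
  simpa using h

theorem vec_geodesic_circlePt_mem_iff (x : ℝ) {w : EuclideanSpace ℝ (Fin (m + 2))} (hw : ‖w‖ = 1)
    (s : ℝ) : geodesic (circlePt m x) (E w) s ∈ singularity m ↔
      (Real.cos x ^ 2 - w 1 ^ 2) * s ^ 2 - 2 * Real.cos x * Real.sin x * s + Real.sin x ^ 2
          = 0 := by
  rw [mem_singularity_iff, E_eq_rot, vec_geodesic _ (bil_lightVec hw) (lightVec_inl_zero w),
    circlePt_mulVec]
  simp only [Pi.add_apply, Pi.smul_apply, smul_eq_mul, e0_inl_zero, e0_inl_one, e0_inr,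
    lightVec_inl_zero, lightVec_inl_one, lightVec_inr,
    show et m (Sum.inl 1) = 1 by simp [et], show et m (Sum.inr 1) = 0 by simp [et]]
  rw [← sub_eq_zero]
  ring_nf

theorem proj_circlePt_mem_iff (x : ℝ) : proj (circlePt m x) ∈ singularity m ↔ Real.sin x = 0 := by
  rw [mem_singularity_iff, vec_proj, circlePt_mulVec]
  simp only [Pi.add_apply, Pi.smul_apply, smul_eq_mul, e0_inl_zero, e0_inl_one, e0_inr,
    show et m (Sum.inl 1) = 1 by simp [et], show et m (Sum.inr 1) = 0 by simp [et]]
  simp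

/-! ### The Killing form on `𝒬` -/

/-- As `Z` is skew, `Z e₀` is orthogonal to `e₀` and `Z n` to `n`, so `X` maps them to multiples of
`e₀` and `n`. On the image of `ad X`, the square of `ad X` is then the scalar `-⟨n, n⟩`. -/
theorem ad_rot_e0_pow_three {n : Idx m → ℝ} (h0 : n (Sum.inl 0) = 0) :
    LieAlgebra.ad ℝ (LieG m) (rot (e0 m) n) * LieAlgebra.ad ℝ (LieG m) (rot (e0 m) n) *
      LieAlgebra.ad ℝ (LieG m) (rot (e0 m) n)
      = (-bil m n n) • LieAlgebra.ad ℝ (LieG m) (rot (e0 m) n) := by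
  refine LinearMap.ext fun Z => ?_
  have hen : bil m (e0 m) n = 0 := by rw [e0_bil, h0]
  have hne : bil m n (e0 m) = 0 := by rw [bil_comm, hen]
  have hee : bil m (e0 m) (e0 m) = 1 := by rw [e0_bil, e0_inl_zero]
  set ν := bil m n n with hν
  set a := Z.1 *ᵥ e0 m with ha
  set b := Z.1 *ᵥ n with hb
  set X := rot (e0 m) n with hX
  have hXe : X.1 *ᵥ e0 m = n := by rw [hX, rot_mulVec, hee, hne]; module
  have hXn : X.1 *ᵥ n = (-ν) • e0 m := by rw [hX, rot_mulVec, hen, ← hν]; module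
  have hea : bil m (e0 m) a = 0 := Z.bil_self _
  have hnb : bil m n b = 0 := Z.bil_self _
  have heb : bil m (e0 m) b = -bil m n a := by
    rw [ha, hb, bil_comm n, Z.bil_left, neg_neg]
  have hXa : X.1 *ᵥ a = (-bil m n a) • e0 m := by rw [hX, rot_mulVec, hea]; module
  have hXb : X.1 *ᵥ b = (-bil m n a) • n := by rw [hX, rot_mulVec, hnb, heb]; module
  have h1 : ⁅X, Z⁆ = -(rot a n + rot (e0 m) b) := by rw [← lie_skew, hX, lie_rot]
  have swap : ∀ (c : ℝ) (f w : Idx m → ℝ), rot (c • f) w = c • rot f w := fun c f w => by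
    rw [rot_swap, rot_smul, rot_swap w, smul_neg, neg_neg]
  have h2 : ⁅X, ⁅X, rot a n + rot (e0 m) b⁆⁆ = (-ν) • (rot a n + rot (e0 m) b) := by
    simp only [lie_add, lie_rot, hXa, hXn, hXe, hXb, swap, rot_smul, lie_smul, rot_self, smul_zero]
    module
  change ⁅X, ⁅X, ⁅X, Z⁆⁆⁆ = (-ν) • ⁅X, Z⁆
  rw [h1, lie_neg, lie_neg, h2, smul_neg]

theorem ad_rot_e0_ne_zero {n : Idx m → ℝ} (h0 : n (Sum.inl 0) = 0) (hn : bil m n n ≠ 0) :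
    LieAlgebra.ad ℝ (LieG m) (rot (e0 m) n) ≠ 0 := by
  intro had
  have hen : bil m (e0 m) n = 0 := by rw [e0_bil, h0]
  have hne : bil m n (e0 m) = 0 := by rw [bil_comm, hen]
  have hee : bil m (e0 m) (e0 m) = 1 := by rw [e0_bil, e0_inl_zero]
  have key : ∀ y : Idx m → ℝ, ∀ i, i ≠ Sum.inl 0 → bil m n n * y i - bil m y n * n i = 0 := by
    intro y i hi
    have h1 : ⁅rot (e0 m) n, rot (e0 m) y⁆ = 0 := LinearMap.congr_fun had (rot (e0 m) y)
    have h2 := congrArg (fun Z : LieG m => (Z.1 *ᵥ n) i) h1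
    simp only [lie_rot, LieG.add_mulVec] at h2
    rw [rot_mulVec (e0 m) n (e0 m), hee, hne, rot_mulVec, rot_mulVec (e0 m) _ n, hen] at h2
    have h3 : e0 m i = 0 := Pi.single_eq_of_ne hi _
    have h4 : (((0 : LieG m).1 *ᵥ n) i : ℝ) = 0 := congrFun (Matrix.zero_mulVec n) i
    rw [h4] at h2
    simpa [h3] using h2
  -- A time-like and a space-like test vector give `⟨n, n⟩ = n_t²` and `⟨n, n⟩ = -n_{x₁}²`.
  have k1 := key (et m) (Sum.inl 1) (by simp)
  have k2 := key (ex 0) (Sum.inr 0) (by simp)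
  rw [et_bil, show et m (Sum.inl 1) = 1 by simp [et]] at k1
  rw [ex_bil, show ex (m := m) 0 (Sum.inr 0) = 1 by simp [ex]] at k2
  apply hn
  nlinarith [mul_self_nonneg (n (Sum.inl 1)), mul_self_nonneg (n (Sum.inr 0))]

theorem killingForm_rot_e0_eq_zero_iff {n : Idx m → ℝ} (h0 : n (Sum.inl 0) = 0) :
    killingForm ℝ (LieG m) (rot (e0 m) n) (rot (e0 m) n) = 0 ↔ bil m n n = 0 := by
  have h3 := ad_rot_e0_pow_three h0
  have hne := ad_rot_e0_ne_zero h0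
  rw [killingForm_apply_apply]
  change LinearMap.trace ℝ (LieG m) (LieAlgebra.ad ℝ (LieG m) (rot (e0 m) n) *
    LieAlgebra.ad ℝ (LieG m) (rot (e0 m) n)) = 0 ↔ _
  revert h3 hne
  generalize LieAlgebra.ad ℝ (LieG m) (rot (e0 m) n) = A
  intro h3 hne
  constructor
  · intro htr
    by_contra hν
    -- An idempotent of trace 0 is zero in characteristic 0. Then `A² = 0`, and the cubic relation
    -- forces `A = 0`.
    have hid : IsIdempotentElem ((-bil m n n)⁻¹ • (A * A)) := by
      rw [IsIdempotentElem, smul_mul_smul_comm, ← mul_assoc, h3, smul_mul_assoc, smul_smul,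
        mul_assoc, inv_mul_cancel₀ (neg_ne_zero.2 hν), mul_one]
    have hz := LinearMap.IsIdempotentElem.eq_zero_of_trace_eq_zero hid
      (by rw [map_smul, htr, smul_zero])
    rw [smul_eq_zero] at hz
    have hAA := hz.resolve_left (inv_ne_zero (neg_ne_zero.2 hν))
    rw [hAA, zero_mul] at h3
    exact hne hν ((smul_eq_zero.1 h3.symm).resolve_left (neg_ne_zero.2 hν))
  · intro hν
    rw [hν, neg_zero, zero_smul] at h3
    exact (LinearMap.isNilpotent_trace_of_isNilpotent
      ⟨2, by rw [sq, ← mul_assoc, h3, zero_mul]⟩).eq_zero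

/-! ### Light-like vectors -/

theorem sigmaMat_mulVec (v : Idx m → ℝ) :
    sigmaMat m *ᵥ v = (2 * v (Sum.inl 0)) • e0 m - v := by
  funext i
  rw [sigmaMat, mulVec_diagonal]
  by_cases h : i = Sum.inl 0
  · subst h
    simp [e0]; ring
  · simp [e0, h]

theorem sigma_mulVec (X : LieG m) (v : Idx m → ℝ) :
    (sigma m X).1 *ᵥ v = sigmaMat m *ᵥ (X.1 *ᵥ (sigmaMat m *ᵥ v)) := by
  change (sigmaMat m * X.1 * sigmaMat m) *ᵥ v = _
  rw [mulVec_mulVec, mulVec_mulVec]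

theorem eq_rot_of_mem_spaceQ {X : LieG m} (hX : X ∈ spaceQ m) :
    X = rot (e0 m) (X.1 *ᵥ e0 m) := by
  refine LieG.ext_mulVec fun v => ?_
  have key : ∀ v, sigmaMat m *ᵥ (X.1 *ᵥ (sigmaMat m *ᵥ v)) = -(X.1 *ᵥ v) := fun v => by
    rw [← sigma_mulVec, Module.End.mem_eigenspace_iff.1 hX, LieG.smul_mulVec, neg_one_smul]
  have h1 := key v
  have h2 : (X.1 *ᵥ e0 m) (Sum.inl 0) = 0 := (e0_bil _).symm.trans (X.bil_self _)
  have h3 : (X.1 *ᵥ v) (Sum.inl 0) = -bil m (X.1 *ᵥ e0 m) v := by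
    rw [X.bil_left, e0_bil, neg_neg]
  rw [sigmaMat_mulVec v, mulVec_sub, mulVec_smul, mulVec_sub, mulVec_smul, sigmaMat_mulVec,
    sigmaMat_mulVec, h2, h3] at h1
  rw [rot_mulVec, e0_bil]
  have h4 : (2 : ℝ) • (X.1 *ᵥ v) = (2 : ℝ) • (v (Sum.inl 0) • (X.1 *ᵥ e0 m) -
      bil m (X.1 *ᵥ e0 m) v • e0 m) := by
    rw [← sub_eq_zero] at h1 ⊢
    rw [← h1]
    module
  exact smul_right_injective _ (two_ne_zero' ℝ) h4

theorem rot_e0_mem_spaceQ {n : Idx m → ℝ} (h0 : n (Sum.inl 0) = 0) :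
    rot (e0 m) n ∈ spaceQ m := by
  refine Module.End.mem_eigenspace_iff.2 (LieG.ext_mulVec fun v => ?_)
  have hne : bil m n (e0 m) = 0 := by rw [bil_comm, e0_bil, h0]
  rw [sigma_mulVec, LieG.smul_mulVec, rot_mulVec, rot_mulVec, sigmaMat_mulVec, sigmaMat_mulVec]
  simp only [map_sub, map_smul, e0_bil, hne, Pi.sub_apply, Pi.smul_apply, smul_eq_mul, h0,
    e0_inl_zero]
  module

theorem rot_e0_mem_spaceP_iff {n : Idx m → ℝ} (h0 : n (Sum.inl 0) = 0) :
    rot (e0 m) n ∈ spaceP m ↔ n (Sum.inl 1) = 0 := by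
  have hne : ∀ {n : Idx m → ℝ}, n (Sum.inl 0) = 0 → (rot (e0 m) n).1 *ᵥ e0 m = n :=
    fun {n} h0 => by rw [rot_mulVec, e0_bil, bil_comm, e0_bil, h0, e0_inl_zero]; module
  rw [spaceP, Module.End.mem_eigenspace_iff, theta_rot, etaMat_e0, ← rot_smul, neg_one_smul]
  constructor
  · intro h
    have h1 := congrArg (fun Z : LieG m => (Z.1 *ᵥ e0 m) (Sum.inl 1)) h
    rw [hne (by rw [etaMat_mulVec_inl, h0]), hne (by rw [Pi.neg_apply, h0, neg_zero]),
      etaMat_mulVec_inl, Pi.neg_apply] at h1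
    linarith
  · intro h
    congr 1
    ext (i | i)
    · fin_cases i
      · simp [etaMat_mulVec_inl, h0]
      · simp [etaMat_mulVec_inl, h]
    · rw [etaMat_mulVec_inr, Pi.neg_apply]

/-- As `rot e₀ e_t = -q₀`, the `q₀`-coefficient is minus the `t`-component of `n`: the future is the
side of negative `t`. -/
theorem isFutureLightlike_rot_e0_iff {n : Idx m → ℝ} (h0 : n (Sum.inl 0) = 0) :
    IsFutureLightlike (rot (e0 m) n) ↔ bil m n n = 0 ∧ n (Sum.inl 1) < 0 := by
  have h : ∀ c : ℝ, rot (e0 m) n - c • q0 m ∈ spaceP m ↔ n (Sum.inl 1) + c = 0 := by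
    intro c
    have e : rot (e0 m) n - c • q0 m = rot (e0 m) (n + c • et m) := by
      rw [rot_add, rot_smul, rot_e0_et]; module
    have h0' : (n + c • et m) (Sum.inl 0) = 0 := by simp [h0, et]
    rw [e, rot_e0_mem_spaceP_iff h0']
    simp [et]
  rw [IsFutureLightlike, killingForm_rot_e0_eq_zero_iff h0]
  simp only [h]
  constructor
  · rintro ⟨-, h1, c, hc, h2⟩
    exact ⟨h1, by linarith⟩
  · rintro ⟨h1, h2⟩
    exact ⟨rot_e0_mem_spaceQ h0, h1, -n (Sum.inl 1), by linarith, by ring⟩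

theorem isFutureLightlike_E {w : EuclideanSpace ℝ (Fin (m + 2))} (hw : ‖w‖ = 1) :
    IsFutureLightlike (E w) := by
  rw [E_eq_rot, isFutureLightlike_rot_e0_iff (lightVec_inl_zero w), lightVec_inl_one]
  exact ⟨bil_lightVec hw, by norm_num⟩

/-! ### Time orientation -/

instance : PreconnectedSpace (GroupG m) :=
  isPreconnected_iff_preconnectedSpace.1
    (isPreconnected_connectedComponent (x := (1 : fullSO m)))

theorem preconnectedSpace_AdS : PreconnectedSpace (AdS m) :=
  ⟨by
    rw [← QuotientGroup.mk_surjective.range_eq]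
    exact isPreconnected_range continuous_quotient_mk'⟩

theorem mulVec_e0_apply (M : Matrix (Idx m) (Idx m) ℝ) (i : Idx m) :
    (M *ᵥ e0 m) i = M i (Sum.inl 0) := by simp [e0]

theorem mulVec_et_apply (M : Matrix (Idx m) (Idx m) ℝ) (i : Idx m) :
    (M *ᵥ et m) i = M i (Sum.inl 1) := by simp [et]

/-- A kernel vector of the block would be a vector of the positive definite `(u, t)`-plane sent to a
purely spatial one, against isometry. -/
theorem timeBlock_ne_zero (g : GroupG m) :
    g.mat (Sum.inl 0) (Sum.inl 0) * g.mat (Sum.inl 1) (Sum.inl 1)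
      - g.mat (Sum.inl 0) (Sum.inl 1) * g.mat (Sum.inl 1) (Sum.inl 0) ≠ 0 := by
  have key : ∀ α β : ℝ, g.mat (Sum.inl 0) (Sum.inl 0) * α + g.mat (Sum.inl 0) (Sum.inl 1) * β = 0 →
      g.mat (Sum.inl 1) (Sum.inl 0) * α + g.mat (Sum.inl 1) (Sum.inl 1) * β = 0 →
      α = 0 ∧ β = 0 := by
    intro α β h1 h2
    have h3 := g.bil_mat (α • e0 m + β • et m) (α • e0 m + β • et m)
    rw [bil_apply (g.mat *ᵥ _)] at h3
    have h4 : ∀ i, (g.mat *ᵥ (α • e0 m + β • et m)) i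
        = g.mat i (Sum.inl 0) * α + g.mat i (Sum.inl 1) * β := fun i => by
      rw [mulVec_add, mulVec_smul, mulVec_smul]
      simp only [Pi.add_apply, Pi.smul_apply, smul_eq_mul, mulVec_e0_apply, mulVec_et_apply]
      ring
    rw [h4, h4, h1, h2] at h3
    have h5 : bil m (α • e0 m + β • et m) (α • e0 m + β • et m) = α ^ 2 + β ^ 2 := by
      simp only [map_add, map_smul, LinearMap.add_apply, LinearMap.smul_apply, e0_bil, et_bil,
        e0_inl_zero, e0_inl_one, show et m (Sum.inl 0) = 0 by simp [et],
        show et m (Sum.inl 1) = 1 by simp [et], smul_eq_mul]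
      ring
    have h6 := Finset.sum_nonneg fun (i : Fin (m + 2)) (_ : i ∈ Finset.univ) =>
      mul_self_nonneg ((g.mat *ᵥ (α • e0 m + β • et m)) (Sum.inr i))
    rw [h5] at h3
    constructor <;> nlinarith [sq_nonneg α, sq_nonneg β]
  intro h
  -- When the determinant is zero, the columns of the adjugate are in the kernel. Hence all four
  -- entries vanish, and `(1, 0)` is in the kernel as well.
  have h1 := key (g.mat (Sum.inl 1) (Sum.inl 1)) (-g.mat (Sum.inl 1) (Sum.inl 0))
    (by linarith) (by ring)
  have h2 := key 1 0
  have h3 := key (g.mat (Sum.inl 0) (Sum.inl 1)) (-g.mat (Sum.inl 0) (Sum.inl 0))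
    (by ring) (by linarith)
  have h4 := h2 (by linarith [h3.2]) (by linarith [h1.2])
  exact one_ne_zero h4.1

theorem timeBlock_pos (g : GroupG m) :
    0 < g.mat (Sum.inl 0) (Sum.inl 0) * g.mat (Sum.inl 1) (Sum.inl 1)
      - g.mat (Sum.inl 0) (Sum.inl 1) * g.mat (Sum.inl 1) (Sum.inl 0) := by
  by_contra! hle
  have hc : Continuous fun g : GroupG m => g.mat (Sum.inl 0) (Sum.inl 0) *
      g.mat (Sum.inl 1) (Sum.inl 1)
      - g.mat (Sum.inl 0) (Sum.inl 1) * g.mat (Sum.inl 1) (Sum.inl 0) := by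
    have hij : ∀ i j, Continuous fun g : GroupG m => g.mat i j := fun i j =>
      continuous_mat.matrix_elem i j
    exact ((hij _ _).mul (hij _ _)).sub ((hij _ _).mul (hij _ _))
  obtain ⟨k, hk⟩ := mem_range_of_exists_le_of_exists_ge hc ⟨g, hle⟩
    ⟨1, by rw [GroupG.mat_one]; simp⟩
  exact timeBlock_ne_zero k hk

/-- An element of `G` fixing `e₀` preserves the time orientation of light-like vectors. -/
theorem mulVec_inl_one_neg {h : GroupG m} (hh : h.mat *ᵥ e0 m = e0 m) {n : Idx m → ℝ}
    (h0 : n (Sum.inl 0) = 0) (hn : bil m n n = 0) (hneg : n (Sum.inl 1) < 0) :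
    (h.mat *ᵥ n) (Sum.inl 1) < 0 := by
  have hfix : ∀ v : Idx m → ℝ, (h.mat *ᵥ v) (Sum.inl 0) = v (Sum.inl 0) := fun v => by
    have h1 := h.bil_mat (e0 m) v
    rwa [hh, e0_bil, e0_bil] at h1
  have hpos := timeBlock_pos h
  -- Since `h` fixes `e₀`, the determinant of the time block is the `t`-component of `h e_t`.
  rw [← mulVec_e0_apply h.mat (Sum.inl 0), ← mulVec_e0_apply h.mat (Sum.inl 1),
    ← mulVec_et_apply h.mat (Sum.inl 1), hh, e0_inl_zero, e0_inl_one, one_mul, mul_zero,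
    sub_zero] at hpos
  have hyz := h.bil_mat n (et m)
  have hyy := h.bil_mat n n
  have hzz := h.bil_mat (et m) (et m)
  rw [bil_apply, hfix, h0, bil_comm, et_bil] at hyz
  rw [hn, bil_apply, hfix, h0] at hyy
  rw [bil_apply, hfix, et_bil, show et m (Sum.inl 1) = 1 by simp [et],
    show et m (Sum.inl 0) = 0 by simp [et]] at hzz
  by_contra! hy
  set y := h.mat *ᵥ n
  set z := h.mat *ᵥ et m
  -- Cauchy–Schwarz bounds the square of the spatial product by `y_t² (z_t² - 1)`, whereas `⟨y, z⟩ <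
  -- 0` with `y_t z_t ≥ 0` would make it exceed `y_t² z_t²`.
  have hcs := Finset.sum_mul_sq_le_sq_mul_sq Finset.univ (fun i : Fin (m + 2) => y (Sum.inr i))
    (fun i => z (Sum.inr i))
  simp only [sq (y _), sq (z _)] at hcs
  have e1 : ∑ i : Fin (m + 2), y (Sum.inr i) * y (Sum.inr i) = y (Sum.inl 1) ^ 2 := by linarith
  have e2 : ∑ i : Fin (m + 2), z (Sum.inr i) * z (Sum.inr i) = z (Sum.inl 1) ^ 2 - 1 := by linarith
  rw [e1, e2] at hcs
  have hyz0 : 0 ≤ y (Sum.inl 1) * z (Sum.inl 1) := mul_nonneg hy hpos.le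
  have hlt : y (Sum.inl 1) * z (Sum.inl 1) < ∑ i : Fin (m + 2), y (Sum.inr i) * z (Sum.inr i) := by
    linarith
  nlinarith [pow_lt_pow_left₀ hlt hyz0 two_ne_zero, sq_nonneg (y (Sum.inl 1))]

/-- Up to a positive reparametrization, every future directed light-like geodesic is one of the
geodesics in the directions `E(w)`. -/
theorem exists_geodesic_eq {g c : GroupG m} (hgc : proj g = proj c) {X : LieG m}
    (hX : IsFutureLightlike X) : ∃ w : EuclideanSpace ℝ (Fin (m + 2)), ‖w‖ = 1 ∧
      ∃ r : ℝ, 0 < r ∧ ∀ s, geodesic g X s = geodesic c (E w) (r * s) := by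
  have hXrot := eq_rot_of_mem_spaceQ hX.1
  set n := X.1 *ᵥ e0 m with hndef
  have h0 : n (Sum.inl 0) = 0 := (e0_bil _).symm.trans (X.bil_self _)
  rw [hXrot] at hX
  obtain ⟨hn, hneg⟩ := (isFutureLightlike_rot_e0_iff h0).1 hX
  have hg : g.mat *ᵥ e0 m = c.mat *ᵥ e0 m := by rw [← vec_proj, hgc, vec_proj]
  have hh : (c⁻¹ * g).mat *ᵥ e0 m = e0 m := by
    rw [GroupG.mul_mulVec]; exact GroupG.inv_mulVec_eq hg.symm
  have hneg' := mulVec_inl_one_neg hh h0 hn hneg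
  set y := (c⁻¹ * g).mat *ᵥ n with hy
  have hcy : c.mat *ᵥ y = g.mat *ᵥ n := by rw [hy, ← GroupG.mul_mulVec, mul_inv_cancel_left]
  have hy0 : y (Sum.inl 0) = 0 := by
    have h1 := (c⁻¹ * g).bil_mat (e0 m) n
    rwa [hh, e0_bil, e0_bil, h0] at h1
  have hyy : bil m y y = 0 := by rw [hy, GroupG.bil_mat, hn]
  set r := -y (Sum.inl 1) with hr
  have hr0 : 0 < r := by linarith
  let w : EuclideanSpace ℝ (Fin (m + 2)) := WithLp.toLp 2 fun i => y (Sum.inr i) / r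
  have hwi : ∀ i, w i = y (Sum.inr i) / r := fun i => rfl
  have hw : ‖w‖ = 1 := by
    have h1 : ‖w‖ ^ 2 = 1 := by
      rw [EuclideanSpace.real_norm_sq_eq]
      simp only [hwi, div_pow]
      rw [← Finset.sum_div, div_eq_one_iff_eq (by positivity), hr]
      rw [bil_apply, hy0] at hyy
      simp only [sq]
      linarith
    exact (pow_eq_one_iff_of_nonneg (norm_nonneg w) two_ne_zero).1 h1
  refine ⟨w, hw, r, hr0, fun s => vec_injective ?_⟩
  have hyw : y = r • lightVec w := by
    ext (i | i)
    · fin_cases i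
      · simp [lightVec_inl_zero, hy0]
      · simp [lightVec_inl_one, hr]
    · rw [Pi.smul_apply, lightVec_inr, hwi, smul_eq_mul, mul_div_cancel₀ _ hr0.ne']
  rw [hXrot, E_eq_rot, vec_geodesic g hn h0, vec_geodesic c (bil_lightVec hw) (lightVec_inl_zero w),
    mulVec_add, mulVec_add, mulVec_smul, hg, ← hcy, hyw, mulVec_smul, mulVec_smul, smul_smul,
    mul_comm]

theorem proj_mem_blackHole_iff (c : GroupG m) : proj c ∈ blackHole m ↔
    ∀ w : EuclideanSpace ℝ (Fin (m + 2)), ‖w‖ = 1 →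
      ∃ s : ℝ, 0 < s ∧ geodesic c (E w) s ∈ singularity m := by
  constructor
  · exact fun h w hw => h c rfl _ (isFutureLightlike_E hw)
  · intro h g hg X hX
    obtain ⟨w, hw, r, hr, he⟩ := exists_geodesic_eq hg hX
    obtain ⟨s, hs, hmem⟩ := h w hw
    refine ⟨s / r, div_pos hs hr, ?_⟩
    rwa [he, mul_div_cancel₀ _ hr.ne']

/-! ### The circle `[SO(2)]` -/

theorem geodesic_circlePt_mem_iff_eq_div (x : ℝ) {w : EuclideanSpace ℝ (Fin (m + 2))}
    (hw : ‖w‖ = 1) (hx : Real.sin x ≠ 0 ∨ Real.cos x ^ 2 ≠ w 1 ^ 2) (s : ℝ) :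
    geodesic (circlePt m x) (E w) s ∈ singularity m ↔
      (Real.cos x - w 1 ≠ 0 ∧ s = Real.sin x / (Real.cos x - w 1)) ∨
      (Real.cos x + w 1 ≠ 0 ∧ s = Real.sin x / (Real.cos x + w 1)) := by
  rw [vec_geodesic_circlePt_mem_iff x hw]
  have hfac : (Real.cos x ^ 2 - w 1 ^ 2) * s ^ 2 - 2 * Real.cos x * Real.sin x * s
      + Real.sin x ^ 2 = ((Real.cos x - w 1) * s - Real.sin x) *
        ((Real.cos x + w 1) * s - Real.sin x) := by ring
  -- The hypothesis on `x` and `w` excludes the degenerate factor `0 · s - 0`, which every `s` would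
  -- satisfy.
  have hne : ∀ {a : ℝ}, a = 0 → Real.sin x = 0 →
      (a = Real.cos x - w 1 ∨ a = Real.cos x + w 1) → False := by
    intro a ha hs h
    rcases hx with h1 | h1
    · exact h1 hs
    · rcases h with h | h <;> apply h1 <;> rw [ha] at h
      · rw [sub_eq_zero.1 h.symm]
      · rw [eq_neg_of_add_eq_zero_left h.symm, neg_sq]
  have hiff : ∀ a : ℝ, (a = Real.cos x - w 1 ∨ a = Real.cos x + w 1) →
      (a * s - Real.sin x = 0 ↔ a ≠ 0 ∧ s = Real.sin x / a) := by
    intro a ha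
    constructor
    · intro h
      have ha0 : a ≠ 0 := by
        intro h0
        rw [h0] at h
        exact hne h0 (by linarith) ha
      exact ⟨ha0, by rw [eq_div_iff ha0]; linarith⟩
    · rintro ⟨ha0, h⟩
      rw [h, mul_div_cancel₀ _ ha0, sub_self]
  rw [hfac, mul_eq_zero, hiff _ (Or.inl rfl), hiff _ (Or.inr rfl)]

theorem geodesic_circlePt_not_mem {x : ℝ} (hs : 0 < Real.sin x) (hc : Real.cos x < 0)
    {w : EuclideanSpace ℝ (Fin (m + 2))} (hw : ‖w‖ = 1) (hw1 : |w 1| < |Real.cos x|) {s : ℝ}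
    (hs0 : 0 < s) : geodesic (circlePt m x) (E w) s ∉ singularity m := by
  rw [geodesic_circlePt_mem_iff_eq_div x hw (Or.inl hs.ne')]
  rw [abs_of_neg hc, abs_lt] at hw1
  rintro (⟨-, h⟩ | ⟨-, h⟩)
  · have := div_neg_of_pos_of_neg hs (show Real.cos x - w 1 < 0 by linarith)
    linarith
  · have := div_neg_of_pos_of_neg hs (show Real.cos x + w 1 < 0 by linarith)
    linarith

theorem exists_geodesic_circlePt_mem {x : ℝ} (hs : 0 < Real.sin x) (hc : 0 < Real.cos x)
    {w : EuclideanSpace ℝ (Fin (m + 2))} (hw : ‖w‖ = 1) :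
    ∃ s : ℝ, 0 < s ∧ geodesic (circlePt m x) (E w) s ∈ singularity m := by
  -- The sign of `w₂` selects the denominator that is at least `cos x`.
  rcases le_total 0 (w 1) with h | h
  · have hpos : 0 < Real.cos x + w 1 := by linarith
    exact ⟨_, div_pos hs hpos, (geodesic_circlePt_mem_iff_eq_div x hw (Or.inl hs.ne') _).2
      (Or.inr ⟨hpos.ne', rfl⟩)⟩
  · have hpos : 0 < Real.cos x - w 1 := by linarith
    exact ⟨_, div_pos hs hpos, (geodesic_circlePt_mem_iff_eq_div x hw (Or.inl hs.ne') _).2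
      (Or.inl ⟨hpos.ne', rfl⟩)⟩

theorem exists_norm_eq_one_apply_eq_zero :
    ∃ w : EuclideanSpace ℝ (Fin (m + 2)), ‖w‖ = 1 ∧ w 1 = 0 :=
  ⟨EuclideanSpace.single 0 1, by simp, by simp⟩

theorem circlePt_mem_blackHole {x : ℝ} (hs : 0 < Real.sin x) (hc : 0 < Real.cos x) :
    proj (circlePt m x) ∈ blackHole m :=
  (proj_mem_blackHole_iff _).2 fun _ hw => exists_geodesic_circlePt_mem hs hc hw

theorem circlePt_not_mem_blackHole {x : ℝ} (hs : 0 < Real.sin x) (hc : Real.cos x < 0) :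
    proj (circlePt m x) ∉ blackHole m := by
  intro h
  obtain ⟨w, hw, hw1⟩ := exists_norm_eq_one_apply_eq_zero (m := m)
  obtain ⟨s, hs0, hmem⟩ := (proj_mem_blackHole_iff _).1 h w hw
  exact geodesic_circlePt_not_mem hs hc hw (by rw [hw1, abs_zero]; exact abs_pos.2 hc.ne) hs0 hmem

theorem forall_geodesic_not_mem_iff {x : ℝ} (hc : Real.cos x = 0)
    {w : EuclideanSpace ℝ (Fin (m + 2))} (hw : ‖w‖ = 1) :
    (∀ s : ℝ, 0 < s → geodesic (circlePt m x) (E w) s ∉ singularity m) ↔ w 1 = 0 := by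
  have hs : Real.sin x ^ 2 = 1 := by
    have := Real.sin_sq_add_cos_sq x
    rw [hc] at this
    linarith
  simp only [vec_geodesic_circlePt_mem_iff x hw, hc, hs]
  constructor
  · intro h
    by_contra hw1
    -- With `cos x = 0` the equation is `w₂² s² = 1`, whose positive root is this one.
    refine h |w 1|⁻¹ (inv_pos.2 (abs_pos.2 hw1)) ?_
    rw [inv_pow, sq_abs]
    field_simp
    ring
  · intro h s _ h2
    rw [h] at h2
    norm_num at h2

/-! ### Existence of a black hole, of free points and of a horizon -/

theorem sin_pi_div_four_pos : 0 < Real.sin (Real.pi / 4) := by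
  rw [Real.sin_pi_div_four]; positivity

theorem cos_pi_div_four_pos : 0 < Real.cos (Real.pi / 4) := by
  rw [Real.cos_pi_div_four]; positivity

theorem blackHole_diff_singularity_nonempty : (blackHole m \ singularity m).Nonempty :=
  ⟨_, circlePt_mem_blackHole sin_pi_div_four_pos cos_pi_div_four_pos,
    fun h => sin_pi_div_four_pos.ne' ((proj_circlePt_mem_iff _).1 h)⟩

theorem exists_not_mem_blackHole : ∃ p : AdS m, p ∉ blackHole m ∧ p ∉ singularity m := by
  have hs : 0 < Real.sin (Real.pi - Real.pi / 4) := by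
    rw [Real.sin_pi_sub]; exact sin_pi_div_four_pos
  have hc : Real.cos (Real.pi - Real.pi / 4) < 0 := by
    rw [Real.cos_pi_sub]; exact neg_neg_of_pos cos_pi_div_four_pos
  exact ⟨_, circlePt_not_mem_blackHole hs hc, fun h => hs.ne' ((proj_circlePt_mem_iff _).1 h)⟩

/-- In a connected space, a subset that is neither empty nor everything has a boundary point. -/
theorem horizon_nonempty : (horizon m).Nonempty := by
  have := preconnectedSpace_AdS (m := m)
  rw [horizon, nonempty_frontier_iff]
  obtain ⟨p, hp, -⟩ := exists_not_mem_blackHole (m := m)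
  exact ⟨blackHole_diff_singularity_nonempty.mono Set.sdiff_subset,
    fun h => hp (h ▸ Set.mem_univ p)⟩

end AdSBlackHole

end

open AdSBlackHole in
theorem mainTheorem3 (m : ℕ) :
    -- the directions `E(w)` are light-like
    (∀ w : EuclideanSpace ℝ (Fin (m + 2)), ‖w‖ = 1 → IsFutureLightlike (E w)) ∧
    -- intersection of the geodesics issued from `[e^{-x q₀}]` with the singularity
    (∀ (x : ℝ) (w : EuclideanSpace ℝ (Fin (m + 2))), ‖w‖ = 1 → ∀ s : ℝ,
      (geodesic (circlePt m x) (E w) s ∈ singularity m ↔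
        (Real.cos x ^ 2 - w 1 ^ 2) * s ^ 2 - 2 * Real.cos x * Real.sin x * s + Real.sin x ^ 2
          = 0)) ∧
    (∀ (x : ℝ) (w : EuclideanSpace ℝ (Fin (m + 2))), ‖w‖ = 1 →
      (Real.sin x ≠ 0 ∨ Real.cos x ^ 2 ≠ w 1 ^ 2) → ∀ s : ℝ,
      (geodesic (circlePt m x) (E w) s ∈ singularity m ↔
        (Real.cos x - w 1 ≠ 0 ∧ s = Real.sin x / (Real.cos x - w 1)) ∨
        (Real.cos x + w 1 ≠ 0 ∧ s = Real.sin x / (Real.cos x + w 1)))) ∧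
    -- points of `[SO(2)]` in the singularity
    (∀ x : ℝ, proj (circlePt m x) ∈ singularity m ↔ Real.sin x = 0) ∧
    -- escaping directions
    (∀ x : ℝ, 0 < Real.sin x → Real.cos x < 0 →
      (∃ w : EuclideanSpace ℝ (Fin (m + 2)), ‖w‖ = 1 ∧ |w 1| < |Real.cos x|) ∧
      (∀ w : EuclideanSpace ℝ (Fin (m + 2)), ‖w‖ = 1 → |w 1| < |Real.cos x| →
        ∀ s : ℝ, 0 < s → geodesic (circlePt m x) (E w) s ∉ singularity m) ∧
      proj (circlePt m x) ∉ blackHole m) ∧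
    -- every light-like direction hits the singularity
    (∀ x : ℝ, 0 < Real.sin x → 0 < Real.cos x →
      (∀ w : EuclideanSpace ℝ (Fin (m + 2)), ‖w‖ = 1 →
        ∃ s : ℝ, 0 < s ∧ geodesic (circlePt m x) (E w) s ∈ singularity m) ∧
      proj (circlePt m x) ∈ blackHole m) ∧
    -- the two points with `cos x = 0`
    (∀ x : ℝ, Real.cos x = 0 → ∀ w : EuclideanSpace ℝ (Fin (m + 2)), ‖w‖ = 1 →
      ((∀ s : ℝ, 0 < s → geodesic (circlePt m x) (E w) s ∉ singularity m) ↔ w 1 = 0)) ∧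
    -- genuine black hole
    (blackHole m \ singularity m).Nonempty ∧
    (blackHole m ∪ singularity m) ≠ Set.univ ∧
    (horizon m).Nonempty := by
  refine ⟨fun w hw => isFutureLightlike_E hw,
    fun x w hw s => vec_geodesic_circlePt_mem_iff x hw s,
    fun x w hw hx s => geodesic_circlePt_mem_iff_eq_div x hw hx s,
    proj_circlePt_mem_iff,
    fun x hs hc => ⟨?_, fun w hw hw1 s hs0 => geodesic_circlePt_not_mem hs hc hw hw1 hs0,
      circlePt_not_mem_blackHole hs hc⟩,
    fun x hs hc => ⟨fun w hw => exists_geodesic_circlePt_mem hs hc hw,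
      circlePt_mem_blackHole hs hc⟩,
    fun x hc w hw => forall_geodesic_not_mem_iff hc hw,
    blackHole_diff_singularity_nonempty, ?_, horizon_nonempty⟩
  · obtain ⟨w, hw, hw1⟩ := exists_norm_eq_one_apply_eq_zero (m := m)
    exact ⟨w, hw, by rw [hw1, abs_zero]; exact abs_pos.2 hc.ne⟩
  · intro h
    obtain ⟨p, hp, hp'⟩ := exists_not_mem_blackHole (m := m)
    exact (h ▸ Set.mem_univ p : p ∈ blackHole m ∪ singularity m).elim hp hp'
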